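/- Let $U\subset\mathbb R^2$ be a bounded open neighbourhood of the origin and let $\Omega$ be the set of pairs $Z=(X,Y)$ of $C^1$ vector fields on $U$; $Z$ stands for the piecewise smooth field equal to $X$ where $x_1x_2>0$ and to $Y$ where $x_1x_2<0$. Put $\det[Z]=X_1Y_2-X_2Y_1$. $Z$ satisfies $(B_1)$ if $X_iY_i(0)<0$, $\det[Z](0)=0$ and $(\det[Z])_{x_i}(0)\neq0$ for $i=1,2$; it satisfies $(B_0)$ if $X_iY_i(0)<0$ for $i=1,2$ and $\det[Z](0)\ne 0$. A Sotomayor–Teixeira transition function is a $C^2$ function $\varphi:\mathbb R\to\mathbb R$ with $\varphi(s)=\operatorname{sgn}(s)$ for $|s|\ge1$ and $\varphi'(s)>0$ for $|s|<1$. Given two transition functions $\varphi,\psi$ and a function $G:\mathbb R^2\to\mathbb R^2$, the double regularization of $Z$ is $$Z^R_{\varepsilon,\eta}=\tfrac12\bigl(1+\varphi(\tfrac{x_1}\varepsilon)\psi(\tfrac{x_2}\eta)\bigr)X+\tfrac12\bigl(1-\varphi(\tfrac{x_1}\varepsilon)\psi(\tfrac{x_2}\eta)\bigr)Y+\xi\,G\bigl(\varphi(\tfrac{x_1}\varepsilon),\psi(\tfrac{x_2}\eta)\bigr).$$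 **Bifurcations.** Let $\dot u=g(u,\mu)$, $u\in\mathbb R^2$, $\mu\in\mathbb R$. A *codimension-one equilibrium* is an equilibrium whose Jacobian $A$ has the simple eigenvalue $0$ and another real eigenvalue $\ne0$, with $w^T[D^2g(v,v)]\ne0$ for right and left null vectors $v,w$ of $A$. The family undergoes a *saddle-node bifurcation* at $(u_0,\mu_0)$ if $u_0$ is a codimension-one equilibrium for $\mu=\mu_0$, $w^Tg_\mu(u_0,\mu_0)\neq0$, and near $u_0$, for $\mu$ close to $\mu_0$, there is no equilibrium on one side of $\mu_0$ and on the other side there are exactly two, a hyperbolic saddle and a hyperbolic node, which depend continuously on $\mu$ and coalesce at $u_0$ for $\mu=\mu_0$. It undergoes a *transcritical bifurcation* at $\mu=\mu_0$ along a curve of equilibria $p(\mu)$ if $p(\mu_0)$ is a codimension-one equilibrium for $\mu=\mu_0$, $w^T\frac{d}{d\mu}\bigl[Dg(p(\mu),\mu)v\bigr]_{\mu=\mu_0}\ne0$, and there is a second curve $q(\mu)$ such that, near $p(\mu_0)$ and for $\mu$ close to $\mu_0$, $p$ and $q$ are $C^1$, the equilibria are exactly $p(\mu)$ and $q(\mu)$,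 $p(\mu_0)=q(\mu_0)$, $p'(\mu_0)\ne q'(\mu_0)$, and for $\mu\neq\mu_0$ one of $p(\mu),q(\mu)$ is a hyperbolic saddle and the other a hyperbolic node, the two types being exchanged at $\mu_0$. A bifurcation of one of these types at $(u_0,\mu_0)$ is *generic in the $C^k$ topology* if for every open set $V\ni(u_0,\mu_0)$ there is $\delta>0$ such that every perturbation $g+h$ of the family, with $h$ of class $C^k$ on $V$ and all its derivatives of order at most $k$ smaller than $\delta$ there, undergoes a bifurcation of the same type at some point of $V$. **Theorem.** Let $Z=(X,Y)\in\Omega$ satisfy $(B_1)$ and let $a=\operatorname{sgn}X_1(0)$, $b=\operatorname{sgn}X_2(0)$, $c_1=\operatorname{sgn}(\det[Z])_{x_2}(0)$, $c_2=\operatorname{sgn}(\det[Z])_{x_1}(0)$. Consider the families $\widetilde Z_\alpha=(\widetilde X_\alpha,\widetilde Y)$ and $\widehat Z_\beta=(\widehat X_\beta,\widehat Y)$ in $\Omega$ given by $$\widetilde X_\alpha=\begin{pmatrix}a-bc_2x_1\\ b+a\alpha\end{pmatrix},\quad \widetilde Y=\begin{pmatrix}-a\\-b+ac_1x_2\end{pmatrix},\quad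 \widehat X_\beta=\begin{pmatrix}a-bc_1x_1-bc_2x_2\\ b+a\beta\end{pmatrix},\quad \widehat Y=\begin{pmatrix}-a\\-b+x_2^2\end{pmatrix}.$$ Let $\varphi,\psi$ be Sotomayor–Teixeira transition functions with $\varphi(0)=0$ and let $\xi=0$. (i) $\widetilde Z_0$ satisfies $(B_1)$ and $\widetilde Z_\alpha$ satisfies $(B_0)$ for all small $\alpha\neq0$. There are $\varepsilon_0,\eta_0>0$ and a function $\alpha_0=\alpha_0(\varepsilon,\eta)$ with $\alpha_0(\varepsilon,\eta)\to0$ as $\varepsilon,\eta\to0^+$, such that for all $(\varepsilon,\eta)\in(0,\varepsilon_0)\times(0,\eta_0)$ the point $(0,-\alpha_0/c_1)$ lies in $U$ and the regularization of $\widetilde Z_\alpha$ undergoes, at $\alpha=\alpha_0(\varepsilon,\eta)$, a transcritical bifurcation along the curve of equilibria $(0,-\alpha/c_1)$. This bifurcation is not generic in the $C^k$ topology, for any $k\ge2$. Thus the codimension (one) is preserved and the genericity is lost. (ii) Suppose that also $\psi(0)=0$. Then $\widehat Z_0$ satisfies $(B_1)$ and $\widehat Z_\beta$ satisfies $(B_0)$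 for all small $\beta\ne0$, and there are $\varepsilon_0,\eta_0>0$ such that for all $(\varepsilon,\eta)\in(0,\varepsilon_0)\times(0,\eta_0)$ the regularization of $\widehat Z_\beta$ undergoes a saddle-node bifurcation at $(x_1,x_2,\beta)=(0,0,0)$, which is generic in the $C^k$ topology for every $k\ge2$. Thus both the codimension and the genericity are preserved. -/

import Mathlib

open Set Filter Topology

noncomputable section

namespace CrossField

/-- An element `Z = (X, Y)` of `Ω`: two `C¹` vector fields on `U`. The piecewise smooth field is
`X` where `x₁ x₂ > 0` and `Y` where `x₁ x₂ < 0`, with switching set `x₁ x₂ = 0`.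
Values outside `U` carry no information. -/
structure PiecewiseField (U : Set (ℝ × ℝ)) where
  X : ℝ × ℝ → ℝ × ℝ
  Y : ℝ × ℝ → ℝ × ℝ
  contDiffOn_X : ContDiffOn ℝ 1 X U
  contDiffOn_Y : ContDiffOn ℝ 1 Y U

/-- `det[Z] = X₁ Y₂ - X₂ Y₁`. -/
def PiecewiseField.det {U : Set (ℝ × ℝ)} (Z : PiecewiseField U) (p : ℝ × ℝ) : ℝ :=
  (Z.X p).1 * (Z.Y p).2 - (Z.X p).2 * (Z.Y p).1

/-- The partial derivatives of `det[Z]` at the origin. -/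
def PiecewiseField.detDx₁ {U : Set (ℝ × ℝ)} (Z : PiecewiseField U) : ℝ :=
  fderiv ℝ Z.det 0 (1, 0)

def PiecewiseField.detDx₂ {U : Set (ℝ × ℝ)} (Z : PiecewiseField U) : ℝ :=
  fderiv ℝ Z.det 0 (0, 1)

/-- Condition `(B₀)`. -/
def PiecewiseField.CondB0 {U : Set (ℝ × ℝ)} (Z : PiecewiseField U) : Prop :=
  (Z.X 0).1 * (Z.Y 0).1 < 0 ∧ (Z.X 0).2 * (Z.Y 0).2 < 0 ∧ Z.det 0 ≠ 0

/-- Condition `(B₁)` (double pseudo-equilibrium). -/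
def PiecewiseField.CondB1 {U : Set (ℝ × ℝ)} (Z : PiecewiseField U) : Prop :=
  (Z.X 0).1 * (Z.Y 0).1 < 0 ∧ (Z.X 0).2 * (Z.Y 0).2 < 0 ∧ Z.det 0 = 0 ∧
    Z.detDx₁ ≠ 0 ∧ Z.detDx₂ ≠ 0

/-- A one-parameter family crossing the codimension-one stratum `(B₁)` exactly at the value `0`:
for small nonzero values of the parameter it lies in the structurally stable stratum `(B₀)`. -/
def CrossesB1 {U : Set (ℝ × ℝ)} (fam : ℝ → PiecewiseField U) : Prop :=
  (fam 0).CondB1 ∧ ∀ᶠ α in 𝓝[≠] (0 : ℝ), (fam α).CondB0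

/-- The family `α ↦ (X̃_α, Ỹ)`. -/
def tildeFamily (U : Set (ℝ × ℝ)) (a b c₁ c₂ α : ℝ) : PiecewiseField U where
  X p := (a - b * c₂ * p.1, b + a * α)
  Y p := (-a, -b + a * c₁ * p.2)
  contDiffOn_X := by fun_prop
  contDiffOn_Y := by fun_prop

/-- The family `β ↦ (X̂_β, Ŷ)`. -/
def hatFamily (U : Set (ℝ × ℝ)) (a b c₁ c₂ β : ℝ) : PiecewiseField U where
  X p := (a - b * c₁ * p.1 - b * c₂ * p.2, b + a * β)
  Y p := (-a, -b + p.2 ^ 2)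
  contDiffOn_X := by fun_prop
  contDiffOn_Y := by fun_prop

/-- Sotomayor--Teixeira transition functions. -/
structure IsSTTransition (φ : ℝ → ℝ) : Prop where
  contDiff : ContDiff ℝ 2 φ
  eq_sign : ∀ s : ℝ, 1 ≤ |s| → φ s = Real.sign s
  deriv_pos : ∀ s : ℝ, |s| < 1 → 0 < deriv φ s

/-- The nonlinear double regularization of `Z`, with `φ_ε(x₁) = φ(x₁/ε)`, `ψ_η(x₂) = ψ(x₂/η)`
and nonlinear term `ξ G`. -/
def PiecewiseField.regularize {U : Set (ℝ × ℝ)} (Z : PiecewiseField U) (φ ψ : ℝ → ℝ)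
    (G : ℝ × ℝ → ℝ × ℝ) (ε η ξ : ℝ) (p : ℝ × ℝ) : ℝ × ℝ :=
  (1 / 2 * (1 + φ (p.1 / ε) * ψ (p.2 / η))) • Z.X p
    + (1 / 2 * (1 - φ (p.1 / ε) * ψ (p.2 / η))) • Z.Y p
    + ξ • G (φ (p.1 / ε), ψ (p.2 / η))

/-! ### Equilibria and local bifurcations of planar families `u' = g(u, μ)` -/

/-- The Jacobian of `g(·, μ)` at `u`. -/
def jac (g : ℝ × ℝ → ℝ → ℝ × ℝ) (u : ℝ × ℝ) (μ : ℝ) : ℝ × ℝ →L[ℝ] ℝ × ℝ :=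
  fderiv ℝ (fun x => g x μ) u

/-- The second derivative `D²g(u, μ)(v, v)` with respect to the state variable. -/
def hess (g : ℝ × ℝ → ℝ → ℝ × ℝ) (u : ℝ × ℝ) (μ : ℝ) (v : ℝ × ℝ) : ℝ × ℝ :=
  iteratedFDeriv ℝ 2 (fun x => g x μ) u ![v, v]

/-- `l₁` and `l₂` are the eigenvalues of `A`, with multiplicity. -/
def HasEigenvalues (A : ℝ × ℝ →L[ℝ] ℝ × ℝ) (l₁ l₂ : ℝ) : Prop :=
  LinearMap.charpoly (A : ℝ × ℝ →ₗ[ℝ] ℝ × ℝ) =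
    (Polynomial.X - Polynomial.C l₁) * (Polynomial.X - Polynomial.C l₂)

/-- `u` is a hyperbolic saddle of `g(·, μ)`. -/
def IsSaddle (g : ℝ × ℝ → ℝ → ℝ × ℝ) (u : ℝ × ℝ) (μ : ℝ) : Prop :=
  g u μ = 0 ∧ ∃ l₁ l₂ : ℝ, l₁ < 0 ∧ 0 < l₂ ∧ HasEigenvalues (jac g u μ) l₁ l₂

/-- `u` is a hyperbolic node of `g(·, μ)`, attracting or repelling. -/
def IsNode (g : ℝ × ℝ → ℝ → ℝ × ℝ) (u : ℝ × ℝ) (μ : ℝ) : Prop :=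
  g u μ = 0 ∧ ∃ l₁ l₂ : ℝ, 0 < l₁ * l₂ ∧ HasEigenvalues (jac g u μ) l₁ l₂

/-- `u` is a nonhyperbolic equilibrium of `g(·, μ)` of codimension one with a zero eigenvalue:
`0` is a simple eigenvalue, the other eigenvalue is a nonzero real number, `v` and `w` are right
and left null vectors and `wᵀ D²g(u, μ)(v, v) ≠ 0`. -/
def IsCodimOneEquilibrium (g : ℝ × ℝ → ℝ → ℝ × ℝ) (u : ℝ × ℝ) (μ : ℝ)
    (v : ℝ × ℝ) (w : ℝ × ℝ →L[ℝ] ℝ) : Prop :=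
  g u μ = 0 ∧ (∃ l : ℝ, l ≠ 0 ∧ HasEigenvalues (jac g u μ) 0 l) ∧
    v ≠ 0 ∧ jac g u μ v = 0 ∧ w ≠ 0 ∧ w.comp (jac g u μ) = 0 ∧ w (hess g u μ v) ≠ 0

/-- The family `g` undergoes a saddle-node bifurcation at `(u₀, μ₀)`: `u₀` is a codimension-one
equilibrium at `μ = μ₀`, unfolded with nonzero speed, and near `u₀` there is no equilibrium on one
side of `μ₀`, and on the other side there are exactly two, a hyperbolic saddle and a hyperbolic
node, that coalesce at `u₀` when `μ = μ₀`. -/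
def SaddleNodeAt (g : ℝ × ℝ → ℝ → ℝ × ℝ) (u₀ : ℝ × ℝ) (μ₀ : ℝ) : Prop :=
  (∃ v w, IsCodimOneEquilibrium g u₀ μ₀ v w ∧ w (deriv (fun μ => g u₀ μ) μ₀) ≠ 0) ∧
  ∃ σ : ℝ, (σ = 1 ∨ σ = -1) ∧ ∃ (N : Set (ℝ × ℝ)) (δ : ℝ) (s n : ℝ → ℝ × ℝ),
    IsOpen N ∧ u₀ ∈ N ∧ 0 < δ ∧ s μ₀ = u₀ ∧ n μ₀ = u₀ ∧
    ContinuousOn s {μ | |μ - μ₀| < δ ∧ 0 ≤ σ * (μ - μ₀)} ∧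
    ContinuousOn n {μ | |μ - μ₀| < δ ∧ 0 ≤ σ * (μ - μ₀)} ∧
    ∀ μ, |μ - μ₀| < δ →
      (σ * (μ - μ₀) < 0 → {u ∈ N | g u μ = 0} = ∅) ∧
      (0 ≤ σ * (μ - μ₀) → {u ∈ N | g u μ = 0} = {s μ, n μ}) ∧
      (0 < σ * (μ - μ₀) → IsSaddle g (s μ) μ ∧ IsNode g (n μ) μ)

/-- The family `g` undergoes a transcritical bifurcation at `μ = μ₀` along the curve of equilibria
`μ ↦ p μ`: `p μ₀` is a codimension-one equilibrium, the zero eigenvalue crosses with nonzero speed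
along `p`, and near `p μ₀` the equilibria are exactly those of the curve `p` and of a second curve
`q`, which cross transversally at `μ = μ₀`; for `μ ≠ μ₀` one of the two equilibria is a hyperbolic
saddle and the other one is a hyperbolic node, and the two types are exchanged at `μ₀`. -/
def TranscriticalAlong (g : ℝ × ℝ → ℝ → ℝ × ℝ) (p : ℝ → ℝ × ℝ) (μ₀ : ℝ) : Prop :=
  (∃ v w, IsCodimOneEquilibrium g (p μ₀) μ₀ v w ∧
    w (deriv (fun μ => jac g (p μ) μ v) μ₀) ≠ 0) ∧
  ∃ (N : Set (ℝ × ℝ)) (δ : ℝ) (q : ℝ → ℝ × ℝ),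
    IsOpen N ∧ p μ₀ ∈ N ∧ 0 < δ ∧ q μ₀ = p μ₀ ∧
    ContDiffOn ℝ 1 p (Ioo (μ₀ - δ) (μ₀ + δ)) ∧ ContDiffOn ℝ 1 q (Ioo (μ₀ - δ) (μ₀ + δ)) ∧
    deriv p μ₀ ≠ deriv q μ₀ ∧
    (∀ μ ∈ Ioo (μ₀ - δ) (μ₀ + δ), {u ∈ N | g u μ = 0} = {p μ, q μ}) ∧
    (((∀ μ ∈ Ioo (μ₀ - δ) μ₀, IsSaddle g (p μ) μ ∧ IsNode g (q μ) μ) ∧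
        (∀ μ ∈ Ioo μ₀ (μ₀ + δ), IsNode g (p μ) μ ∧ IsSaddle g (q μ) μ)) ∨
      ((∀ μ ∈ Ioo (μ₀ - δ) μ₀, IsNode g (p μ) μ ∧ IsSaddle g (q μ) μ) ∧
        (∀ μ ∈ Ioo μ₀ (μ₀ + δ), IsSaddle g (p μ) μ ∧ IsNode g (q μ) μ)))

/-- The family `g` undergoes a transcritical bifurcation at `(u₀, μ₀)`. -/
def TranscriticalAt (g : ℝ × ℝ → ℝ → ℝ × ℝ) (u₀ : ℝ × ℝ) (μ₀ : ℝ) : Prop :=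
  ∃ p : ℝ → ℝ × ℝ, p μ₀ = u₀ ∧ TranscriticalAlong g p μ₀

/-- Genericity (in the `C^k` topology) of a bifurcation of type `B` of the family `g` at
`(u₀, μ₀)`: every sufficiently `C^k`-small perturbation of the family still undergoes a bifurcation
of the same type, at a point near `(u₀, μ₀)`. -/
def IsGenericAt (B : (ℝ × ℝ → ℝ → ℝ × ℝ) → ℝ × ℝ → ℝ → Prop) (k : ℕ)
    (g : ℝ × ℝ → ℝ → ℝ × ℝ) (u₀ : ℝ × ℝ) (μ₀ : ℝ) : Prop :=
  ∀ V : Set ((ℝ × ℝ) × ℝ), IsOpen V → (u₀, μ₀) ∈ V → ∃ δ : ℝ, 0 < δ ∧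
    ∀ h : ℝ × ℝ → ℝ → ℝ × ℝ, ContDiffOn ℝ k (Function.uncurry h) V →
      (∀ z ∈ V, ∀ j : ℕ, j ≤ k → ‖iteratedFDeriv ℝ j (Function.uncurry h) z‖ < δ) →
      ∃ z ∈ V, B (fun u μ => g u μ + h u μ) z.1 z.2

end CrossField

end

/-!
A family `u' = g(u, μ)` of planar vector fields is regarded as a map `F` on `(ℝ × ℝ) × ℝ`, and its
bifurcations of codimension one are read off from the 2-jet of `F` at a point.

**Saddle-node.** A nondegenerate fold is a solution of `F = 0`, `det D_u F = 0` at which the trace,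
the speed `wᵀ F_μ` and the quadratic coefficient `wᵀ D²F(v, v)` do not vanish (`IsFoldJet`). The
equilibria near a fold form a curve `γ(t)`, because `(F, u₂)` is a local diffeomorphism, and
`det D_u F (γ t)` is, up to a nonvanishing factor, the derivative of the parameter along `γ`. The
former vanishes to first order at the fold, its derivative being a multiple of the quadratic
coefficient; so the parameter has a strict extremum there, and the sign of the determinant tells the
saddle from the node on the two halves of the curve (`saddleNodeAt_of_isFoldJet`). The map
`(F, det D_u F)` is itself a local diffeomorphism at a fold. A perturbation which is small in `C²`
changes it by little in `C¹`, so it still takes the value `0` nearby, and nondegeneracy is an open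
condition on the 2-jet (`isGenericAt_saddleNodeAt_of_isFoldJet`). The regularization of
`hatFamily` has a fold at the origin as soon as `εη < 2φ'(0)ψ'(0)` (`isFoldJet_hatFamily`).

**Transcritical.** Write `κ = a b c₂`. On the equilibria of the regularization of `tildeFamily`, the
parameter is a function of the state, and `φ(x₁/ε) ψ(x₂/η) (2 - κ x₁) = κ x₁`
(`tildeFamily_eq_zero_iff`). Since `φ(0) = 0`, Hadamard's factorization `φ(x₁/ε) = x₁ K(x₁)` splits
off the line `x₁ = 0`, which is the known curve of equilibria; what remains is solved for `x₂` by
the inverse function theorem and gives a second branch, a graph `x₂ = Q(x₁)`. The branches meet at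
`x₂ = η s` with `ψ(s) = κε / (2φ'(0))`. They cross transversally, with an exchange of types, if the
derivative of the parameter along the second branch does not vanish at the crossing
(`transcriticalAlong_tildeFamily`); as `η → 0` that derivative is close to `-c₂ = ±1`, uniformly in
`ε`, because `ψ(s)` stays away from `±1` (`exists_transcritical_parameter`).

**Loss of genericity.** At a transcritical point two curves of equilibria with different tangents
meet, so the derivative of `F` has a kernel of dimension two and its two rows are proportional. The
first component of the regularized `tildeFamily` does not depend on the parameter, while the second
one does; hence the first row vanishes, which for `|x₁| < ε`, `|x₂| < η`, `|x₁| < 1` happens only on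
`x₁ = 0`. But there the first component is zero, and adding an arbitrarily small constant to it
removes all equilibria from this line (`not_isGenericAt_transcriticalAt_tildeFamily`).
-/

noncomputable section

namespace CrossField

/-! ### Planar Jacobians -/

/-- The endomorphism of the plane with matrix `!![m₁₁, m₁₂; m₂₁, m₂₂]`. -/
def planarMap (m₁₁ m₁₂ m₂₁ m₂₂ : ℝ) : ℝ × ℝ →L[ℝ] ℝ × ℝ :=
  (m₁₁ • ContinuousLinearMap.fst ℝ ℝ ℝ + m₁₂ • ContinuousLinearMap.snd ℝ ℝ ℝ).prod
    (m₂₁ • ContinuousLinearMap.fst ℝ ℝ ℝ + m₂₂ • ContinuousLinearMap.snd ℝ ℝ ℝ)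

@[simp] lemma planarMap_apply (m₁₁ m₁₂ m₂₁ m₂₂ : ℝ) (x : ℝ × ℝ) :
    planarMap m₁₁ m₁₂ m₂₁ m₂₂ x = (m₁₁ * x.1 + m₁₂ * x.2, m₂₁ * x.1 + m₂₂ * x.2) := by
  simp [planarMap]

lemma eq_planarMap (A : ℝ × ℝ →L[ℝ] ℝ × ℝ) :
    A = planarMap (A (1, 0)).1 (A (0, 1)).1 (A (1, 0)).2 (A (0, 1)).2 := by
  ext <;> simp

lemma hasEigenvalues_planarMap {m₁₁ m₁₂ m₂₁ m₂₂ l₁ l₂ : ℝ} (htr : m₁₁ + m₂₂ = l₁ + l₂)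
    (hdet : m₁₁ * m₂₂ - m₁₂ * m₂₁ = l₁ * l₂) :
    HasEigenvalues (planarMap m₁₁ m₁₂ m₂₁ m₂₂) l₁ l₂ := by
  have hM : LinearMap.toMatrix (Module.Basis.finTwoProd ℝ) (Module.Basis.finTwoProd ℝ)
      (planarMap m₁₁ m₁₂ m₂₁ m₂₂ : ℝ × ℝ →ₗ[ℝ] ℝ × ℝ) = !![m₁₁, m₁₂; m₂₁, m₂₂] := by
    ext i j
    fin_cases i <;> fin_cases j <;> simp [LinearMap.toMatrix_apply]
  rw [HasEigenvalues, ← LinearMap.charpoly_toMatrix _ (Module.Basis.finTwoProd ℝ), hM,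
    Matrix.charpoly_fin_two]
  simp only [Matrix.trace_fin_two, Matrix.det_fin_two, Matrix.of_apply, Matrix.cons_val_zero,
    Matrix.cons_val_one, Matrix.cons_val', Matrix.cons_val_fin_one, htr, hdet, map_add, map_mul]
  ring

/-- A planar Jacobian with negative determinant belongs to a saddle. -/
lemma isSaddle_of_det_neg {g : ℝ × ℝ → ℝ → ℝ × ℝ} {u : ℝ × ℝ} {μ m₁₁ m₁₂ m₂₁ m₂₂ : ℝ}
    (h0 : g u μ = 0) (hJ : jac g u μ = planarMap m₁₁ m₁₂ m₂₁ m₂₂)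
    (hdet : m₁₁ * m₂₂ - m₁₂ * m₂₁ < 0) : IsSaddle g u μ := by
  set d := √((m₁₁ + m₂₂) ^ 2 - 4 * (m₁₁ * m₂₂ - m₁₂ * m₂₁)) with hd
  have hd2 : d ^ 2 = (m₁₁ + m₂₂) ^ 2 - 4 * (m₁₁ * m₂₂ - m₁₂ * m₂₁) :=
    Real.sq_sqrt (by nlinarith [sq_nonneg (m₁₁ + m₂₂)])
  have hlt : |m₁₁ + m₂₂| < d := abs_lt_of_sq_lt_sq (by linarith) (Real.sqrt_nonneg _)
  rw [abs_lt] at hlt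
  refine ⟨h0, (m₁₁ + m₂₂ - d) / 2, (m₁₁ + m₂₂ + d) / 2, by linarith, by linarith, ?_⟩
  rw [hJ]
  exact hasEigenvalues_planarMap (by ring) (by linear_combination hd2 / 4)

/-- A planar Jacobian with positive determinant and positive discriminant belongs to a node. -/
lemma isNode_of_det_pos {g : ℝ × ℝ → ℝ → ℝ × ℝ} {u : ℝ × ℝ} {μ m₁₁ m₁₂ m₂₁ m₂₂ : ℝ}
    (h0 : g u μ = 0) (hJ : jac g u μ = planarMap m₁₁ m₁₂ m₂₁ m₂₂)
    (hdet : 0 < m₁₁ * m₂₂ - m₁₂ * m₂₁)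
    (hdisc : 4 * (m₁₁ * m₂₂ - m₁₂ * m₂₁) < (m₁₁ + m₂₂) ^ 2) : IsNode g u μ := by
  set d := √((m₁₁ + m₂₂) ^ 2 - 4 * (m₁₁ * m₂₂ - m₁₂ * m₂₁)) with hd
  have hd2 : d ^ 2 = (m₁₁ + m₂₂) ^ 2 - 4 * (m₁₁ * m₂₂ - m₁₂ * m₂₁) :=
    Real.sq_sqrt (by linarith)
  refine ⟨h0, (m₁₁ + m₂₂ - d) / 2, (m₁₁ + m₂₂ + d) / 2, by nlinarith, ?_⟩
  rw [hJ]
  exact hasEigenvalues_planarMap (by ring) (by linear_combination hd2 / 4)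

/-- The Jacobian has the eigenvalues `0` and its trace. The null vectors are nonzero because the
quadratic coefficient is. -/
lemma isCodimOneEquilibrium_of_det_eq_zero {g : ℝ × ℝ → ℝ → ℝ × ℝ} {u : ℝ × ℝ}
    {μ m₁₁ m₁₂ m₂₁ m₂₂ : ℝ} {v : ℝ × ℝ} {w : ℝ × ℝ →L[ℝ] ℝ}
    (h0 : g u μ = 0) (hJ : jac g u μ = planarMap m₁₁ m₁₂ m₂₁ m₂₂)
    (hdet : m₁₁ * m₂₂ - m₁₂ * m₂₁ = 0) (htr : m₁₁ + m₂₂ ≠ 0)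
    (hv : planarMap m₁₁ m₁₂ m₂₁ m₂₂ v = 0) (hw : w.comp (planarMap m₁₁ m₁₂ m₂₁ m₂₂) = 0)
    (hq : w (hess g u μ v) ≠ 0) : IsCodimOneEquilibrium g u μ v w := by
  refine ⟨h0, ⟨m₁₁ + m₂₂, htr, ?_⟩, ?_, by rw [hJ, hv], ?_, by rw [hJ, hw], hq⟩
  · rw [hJ]
    exact hasEigenvalues_planarMap (by ring) (by rw [hdet]; ring)
  · rintro rfl
    apply hq
    have : hess g u μ 0 = 0 := by
      rw [hess, iteratedFDeriv_two_apply]; simp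
    rw [this, map_zero]
  · rintro rfl
    exact hq rfl

/-! ### Jets of families -/

/-- The Jacobian of a slice is the restriction of the full derivative. -/
lemma jac_eq_comp_inl {f : ℝ × ℝ → ℝ → ℝ × ℝ} {u : ℝ × ℝ} {μ : ℝ}
    (hf : DifferentiableAt ℝ (Function.uncurry f) (u, μ)) :
    jac f u μ = (fderiv ℝ (Function.uncurry f) (u, μ)).comp
      (ContinuousLinearMap.inl ℝ (ℝ × ℝ) ℝ) := by
  have h1 : HasFDerivAt (fun x : ℝ × ℝ => (x, μ)) (ContinuousLinearMap.inl ℝ (ℝ × ℝ) ℝ) u :=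
    hasFDerivAt_prodMk_left u μ
  exact (hf.hasFDerivAt.comp u h1).fderiv

lemma hess_eq_fderiv_fderiv {f : ℝ × ℝ → ℝ → ℝ × ℝ} {u : ℝ × ℝ} {μ : ℝ}
    (hf : ContDiffAt ℝ 2 (Function.uncurry f) (u, μ)) (v : ℝ × ℝ) :
    hess f u μ v = fderiv ℝ (fderiv ℝ (Function.uncurry f)) (u, μ) (v, 0) (v, 0) := by
  have hev : ∀ᶠ z in 𝓝 (u, μ), ContDiffAt ℝ 2 (Function.uncurry f) z :=
    hf.eventually (by simp)
  have h1 : HasFDerivAt (fun x : ℝ × ℝ => (x, μ)) (ContinuousLinearMap.inl ℝ (ℝ × ℝ) ℝ) u :=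
    hasFDerivAt_prodMk_left u μ
  have hev' : ∀ᶠ x in 𝓝 u, ContDiffAt ℝ 2 (Function.uncurry f) (x, μ) :=
    h1.continuousAt.eventually hev
  have heq : (fderiv ℝ fun x => f x μ) =ᶠ[𝓝 u] fun x =>
      (fderiv ℝ (Function.uncurry f) (x, μ)).comp (ContinuousLinearMap.inl ℝ (ℝ × ℝ) ℝ) :=
    hev'.mono fun x hx => jac_eq_comp_inl (hx.differentiableAt (by norm_num))
  have hd : DifferentiableAt ℝ (fderiv ℝ (Function.uncurry f)) (u, μ) :=
    (hf.fderiv_right (m := 1) (by norm_num)).differentiableAt (by norm_num)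
  have hd' : HasFDerivAt (fun x => fderiv ℝ (Function.uncurry f) (x, μ)) _ u :=
    hd.hasFDerivAt.comp u h1
  have h2 := hd'.clm_comp (hasFDerivAt_const (ContinuousLinearMap.inl ℝ (ℝ × ℝ) ℝ) u)
  rw [hess, iteratedFDeriv_two_apply, heq.fderiv_eq, h2.fderiv]
  simp

/-! ### Fold jets -/

/-- First-order jets of planar families at a point of `(state) × (parameter)` space. -/
abbrev Jet₁ := (ℝ × ℝ) × ℝ →L[ℝ] ℝ × ℝ

/-- Second derivatives of planar families. -/
abbrev Jet₂ := (ℝ × ℝ) × ℝ →L[ℝ] Jet₁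

/-- The determinant of the state part of a 1-jet. -/
def jetDet (A : Jet₁) : ℝ :=
  (A ((1, 0), 0)).1 * (A ((0, 1), 0)).2 - (A ((0, 1), 0)).1 * (A ((1, 0), 0)).2

/-- The trace of the state part of a 1-jet. -/
def jetTrace (A : Jet₁) : ℝ := (A ((1, 0), 0)).1 + (A ((0, 1), 0)).2

/-- The vector `(-m₁₂, m₁₁)`; it is a right null vector when the determinant of the state part
`(mᵢⱼ)` vanishes. -/
def jetKer (A : Jet₁) : ℝ × ℝ := (-(A ((0, 1), 0)).1, (A ((1, 0), 0)).1)

/-- The covector `(-m₂₁, m₁₁)`; it is a left null vector when the determinant of the state part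
`(mᵢⱼ)` vanishes. -/
def jetCoker (A : Jet₁) : ℝ × ℝ →L[ℝ] ℝ :=
  (-(A ((1, 0), 0)).2) • ContinuousLinearMap.fst ℝ ℝ ℝ
    + (A ((1, 0), 0)).1 • ContinuousLinearMap.snd ℝ ℝ ℝ

/-- The speed `wᵀ f_μ` of the unfolding. -/
def jetSpeed (A : Jet₁) : ℝ := jetCoker A (A ((0, 0), 1))

/-- The quadratic coefficient `wᵀ D²f(v, v)`. -/
def jetQuad (A : Jet₁) (T : Jet₂) : ℝ := jetCoker A (T (jetKer A, 0) (jetKer A, 0))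

/-- The open conditions on the 2-jet of a planar family which, together with the equations `f = 0`
and `det = 0`, make up a nondegenerate fold. The upper left entry of the Jacobian is required to be
nonzero, which normalizes the null vectors. -/
structure IsFoldJet (A : Jet₁) (T : Jet₂) : Prop where
  entry_ne : (A ((1, 0), 0)).1 ≠ 0
  trace_ne : jetTrace A ≠ 0
  speed_ne : jetSpeed A ≠ 0
  quad_ne : jetQuad A T ≠ 0

@[simp] lemma jetCoker_apply (A : Jet₁) (y : ℝ × ℝ) :
    jetCoker A y = -(A ((1, 0), 0)).2 * y.1 + (A ((1, 0), 0)).1 * y.2 := by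
  simp [jetCoker]

@[fun_prop] lemma continuous_jetDet : Continuous jetDet := by unfold jetDet; fun_prop
@[fun_prop] lemma continuous_jetTrace : Continuous jetTrace := by unfold jetTrace; fun_prop
@[fun_prop] lemma continuous_jetSpeed : Continuous jetSpeed := by
  unfold jetSpeed; simp only [jetCoker_apply]; fun_prop
@[fun_prop] lemma continuous_jetQuad : Continuous fun p : Jet₁ × Jet₂ => jetQuad p.1 p.2 := by
  have hk : Continuous fun p : Jet₁ × Jet₂ => ((jetKer p.1, 0) : (ℝ × ℝ) × ℝ) := by
    unfold jetKer; fun_prop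
  have hT : Continuous fun p : Jet₁ × Jet₂ => p.2 (jetKer p.1, 0) (jetKer p.1, 0) :=
    (continuous_snd.clm_apply hk).clm_apply hk
  unfold jetQuad; simp only [jetCoker_apply]; fun_prop

lemma isOpen_isFoldJet : IsOpen {p : Jet₁ × Jet₂ | IsFoldJet p.1 p.2} := by
  have : {p : Jet₁ × Jet₂ | IsFoldJet p.1 p.2} =
      (({p | (p.1 ((1, 0), 0)).1 ≠ 0} ∩ {p | jetTrace p.1 ≠ 0}) ∩
        {p | jetSpeed p.1 ≠ 0}) ∩ {p | jetQuad p.1 p.2 ≠ 0} := by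
    ext p
    exact ⟨fun h => ⟨⟨⟨h.1, h.2⟩, h.3⟩, h.4⟩, fun h => ⟨h.1.1.1, h.1.1.2, h.1.2, h.2⟩⟩
  rw [this]
  refine ((IsOpen.inter ?_ ?_).inter ?_).inter ?_ <;>
    exact isOpen_ne_fun (by fun_prop) (by fun_prop)

/-- The derivative of `jetDet` at `A`. -/
def jetDetDeriv (A : Jet₁) : Jet₁ →L[ℝ] ℝ :=
  (A ((1, 0), 0)).1 • (ContinuousLinearMap.snd ℝ ℝ ℝ).comp
      (ContinuousLinearMap.apply ℝ (ℝ × ℝ) ((0, 1), 0))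
    + (A ((0, 1), 0)).2 • (ContinuousLinearMap.fst ℝ ℝ ℝ).comp
      (ContinuousLinearMap.apply ℝ (ℝ × ℝ) ((1, 0), 0))
    - ((A ((0, 1), 0)).1 • (ContinuousLinearMap.snd ℝ ℝ ℝ).comp
      (ContinuousLinearMap.apply ℝ (ℝ × ℝ) ((1, 0), 0))
    + (A ((1, 0), 0)).2 • (ContinuousLinearMap.fst ℝ ℝ ℝ).comp
      (ContinuousLinearMap.apply ℝ (ℝ × ℝ) ((0, 1), 0)))

lemma hasFDerivAt_jetDet (A : Jet₁) : HasFDerivAt jetDet (jetDetDeriv A) A := by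
  have h1 (e : (ℝ × ℝ) × ℝ) : HasFDerivAt (fun A : Jet₁ => (A e).1)
      ((ContinuousLinearMap.fst ℝ ℝ ℝ).comp (ContinuousLinearMap.apply ℝ (ℝ × ℝ) e)) A :=
    ((ContinuousLinearMap.fst ℝ ℝ ℝ).comp (ContinuousLinearMap.apply ℝ (ℝ × ℝ) e)).hasFDerivAt
  have h2 (e : (ℝ × ℝ) × ℝ) : HasFDerivAt (fun A : Jet₁ => (A e).2)
      ((ContinuousLinearMap.snd ℝ ℝ ℝ).comp (ContinuousLinearMap.apply ℝ (ℝ × ℝ) e)) A :=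
    ((ContinuousLinearMap.snd ℝ ℝ ℝ).comp (ContinuousLinearMap.apply ℝ (ℝ × ℝ) e)).hasFDerivAt
  exact ((h1 ((1, 0), 0)).mul (h2 ((0, 1), 0))).sub ((h1 ((0, 1), 0)).mul (h2 ((1, 0), 0)))

/-- When the determinant vanishes, the adjugate of the state part is `v wᵀ / m₁₁`. -/
lemma entry_mul_jetDetDeriv {A : Jet₁} (hdet : jetDet A = 0) (B : Jet₁) :
    (A ((1, 0), 0)).1 * jetDetDeriv A B = jetCoker A (B (jetKer A, 0)) := by
  have hB : B (jetKer A, 0) = (-(A ((0, 1), 0)).1) • B ((1, 0), 0)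
      + (A ((1, 0), 0)).1 • B ((0, 1), 0) := by
    rw [← map_smul, ← map_smul, ← map_add]; simp [jetKer]
  rw [jetCoker_apply, hB]
  simp [jetDetDeriv]
  unfold jetDet at hdet
  linear_combination (B ((1, 0), 0)).1 * hdet

lemma jet_apply (A : Jet₁) (z : (ℝ × ℝ) × ℝ) :
    A z = z.1.1 • A ((1, 0), 0) + z.1.2 • A ((0, 1), 0) + z.2 • A ((0, 0), 1) := by
  rw [← map_smul, ← map_smul, ← map_smul, ← map_add, ← map_add]
  congr 1; ext <;> simp

/-- The kernel of the 1-jet at a fold is spanned by the null vector of the Jacobian. -/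
lemma eq_smul_of_jet_eq_zero {A : Jet₁} (he : (A ((1, 0), 0)).1 ≠ 0) (hdet : jetDet A = 0)
    (hs : jetSpeed A ≠ 0) {z : (ℝ × ℝ) × ℝ} (hz : A z = 0) :
    z = (z.1.2 / (A ((1, 0), 0)).1) • ((jetKer A, 0) : (ℝ × ℝ) × ℝ) := by
  rw [jet_apply] at hz
  have h1 := congrArg Prod.fst hz
  have h2 := congrArg Prod.snd hz
  simp at h1 h2
  have h3 : z.2 = 0 := by
    have : z.2 * jetSpeed A = 0 := by
      simp only [jetSpeed, jetCoker_apply]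
      unfold jetDet at hdet
      linear_combination (A ((1, 0), 0)).1 * h2 - (A ((1, 0), 0)).2 * h1 - z.1.2 * hdet
    exact (mul_eq_zero.1 this).resolve_right hs
  rw [h3] at h1
  refine Prod.ext (Prod.ext ?_ ?_) ?_
  · simp [jetKer]; field_simp; linear_combination h1
  · simp [jetKer]; field_simp
  · simp [h3]

/-! ### Calculus lemmas -/

/-- A function with nonzero derivative at one of its zeros changes sign there. -/
lemma eventually_mul_pos_of_hasDerivAt {D : ℝ → ℝ} {d t₀ : ℝ} (h : HasDerivAt D d t₀)
    (hd : d ≠ 0) (h0 : D t₀ = 0) : ∀ᶠ t in 𝓝 t₀, t ≠ t₀ → 0 < d * D t * (t - t₀) := by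
  have h1 := (hasDerivAt_iff_tendsto_slope.1 h).const_mul d
  have h2 : ∀ᶠ t in 𝓝[≠] t₀, 0 < d * slope D t₀ t :=
    h1.eventually (lt_mem_nhds (mul_self_pos.2 hd))
  rw [eventually_nhdsWithin_iff] at h2
  filter_upwards [h2] with t ht hne
  have h3 := ht hne
  rw [slope_def_field, h0, sub_zero] at h3
  have h4 : 0 < (t - t₀) ^ 2 := by
    have := sub_ne_zero.2 hne
    positivity
  have h5 := mul_pos h3 h4
  have h6 : t - t₀ ≠ 0 := sub_ne_zero.2 hne
  have h7 : d * (D t / (t - t₀)) * (t - t₀) ^ 2 = d * D t * (t - t₀) := by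
    field_simp
  rwa [h7] at h5

/-- An injective continuous function on a compact set has a continuous inverse. -/
lemma exists_continuousOn_rightInverse {f : ℝ → ℝ} {K J : Set ℝ} (hK : IsCompact K)
    (hf : ContinuousOn f K) (hi : InjOn f K) (hJ : J ⊆ f '' K) :
    ∃ g : ℝ → ℝ, ContinuousOn g J ∧ ∀ y ∈ J, g y ∈ K ∧ f (g y) = y := by
  have hg : ∀ y ∈ J, Function.invFunOn f K y ∈ K ∧ f (Function.invFunOn f K y) = y :=
    fun y hy => ⟨Function.invFunOn_mem (hJ hy), Function.invFunOn_eq (hJ hy)⟩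
  refine ⟨Function.invFunOn f K, ?_, hg⟩
  rw [continuousOn_iff_isClosed]
  intro t ht
  refine ⟨f '' (K ∩ t), ((hK.inter_right ht).image_of_continuousOn
    (hf.mono inter_subset_left)).isClosed, ?_⟩
  ext y
  constructor
  · rintro ⟨hy, hyJ⟩
    exact ⟨⟨_, ⟨(hg y hyJ).1, hy⟩, (hg y hyJ).2⟩, hyJ⟩
  · rintro ⟨⟨x, ⟨hxK, hxt⟩, rfl⟩, hyJ⟩
    refine ⟨?_, hyJ⟩
    have := hi (hg _ hyJ).1 hxK (hg _ hyJ).2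
    rwa [mem_preimage, this]

/-- The two branches of the inverse of a function with a strict minimum of value `0` at `t₀`. -/
lemma exists_fold_branches {M M' : ℝ → ℝ} {t₀ ρ r : ℝ} (hr : 0 < r) (hrρ : r < ρ)
    (h0 : M t₀ = 0) (hM : ∀ t ∈ Ioo (t₀ - ρ) (t₀ + ρ), HasDerivAt M (M' t) t)
    (hM' : ∀ t ∈ Ioo (t₀ - ρ) (t₀ + ρ), t ≠ t₀ → 0 < M' t * (t - t₀)) :
    (∀ t ∈ Ioo (t₀ - ρ) (t₀ + ρ), 0 ≤ M t) ∧
    ∃ d > 0, ∃ τ τ' : ℝ → ℝ, ContinuousOn τ (Ico 0 d) ∧ ContinuousOn τ' (Ico 0 d) ∧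
      τ 0 = t₀ ∧ τ' 0 = t₀ ∧ ∀ y ∈ Ico 0 d,
        τ y ∈ Icc t₀ (t₀ + r) ∧ τ' y ∈ Icc (t₀ - r) t₀ ∧ M (τ y) = y ∧ M (τ' y) = y ∧
        ∀ t ∈ Ioo (t₀ - ρ) (t₀ + ρ), M t = y → t = τ y ∨ t = τ' y := by
  have hρ : 0 < ρ := hr.trans hrρ
  have hc : ContinuousOn M (Ioo (t₀ - ρ) (t₀ + ρ)) := fun t ht =>
    (hM t ht).continuousAt.continuousWithinAt
  have hR : StrictMonoOn M (Ico t₀ (t₀ + ρ)) := by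
    refine strictMonoOn_of_deriv_pos (convex_Ico _ _)
      (hc.mono fun t ht => ⟨by linarith [ht.1], ht.2⟩) fun t ht => ?_
    rw [interior_Ico] at ht
    have hm : t ∈ Ioo (t₀ - ρ) (t₀ + ρ) := ⟨by linarith [ht.1], ht.2⟩
    rw [(hM t hm).deriv]
    exact (pos_iff_pos_of_mul_pos (hM' t hm ht.1.ne')).2 (sub_pos.2 ht.1)
  have hL : StrictAntiOn M (Ioc (t₀ - ρ) t₀) := by
    refine strictAntiOn_of_deriv_neg (convex_Ioc _ _)
      (hc.mono fun t ht => ⟨ht.1, by linarith [ht.2]⟩) fun t ht => ?_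
    rw [interior_Ioc] at ht
    have hm : t ∈ Ioo (t₀ - ρ) (t₀ + ρ) := ⟨ht.1, by linarith [ht.2]⟩
    rw [(hM t hm).deriv]
    exact (neg_iff_neg_of_mul_pos (hM' t hm ht.2.ne)).2 (sub_neg.2 ht.2)
  have tR : t₀ ∈ Ico t₀ (t₀ + ρ) := ⟨le_rfl, by linarith⟩
  have tL : t₀ ∈ Ioc (t₀ - ρ) t₀ := ⟨by linarith, le_rfl⟩
  have rR : t₀ + r ∈ Ico t₀ (t₀ + ρ) := ⟨by linarith, by linarith⟩
  have rL : t₀ - r ∈ Ioc (t₀ - ρ) t₀ := ⟨by linarith, by linarith⟩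
  have kR : Icc t₀ (t₀ + r) ⊆ Ico t₀ (t₀ + ρ) := fun t ht => ⟨ht.1, by linarith [ht.2]⟩
  have kL : Icc (t₀ - r) t₀ ⊆ Ioc (t₀ - ρ) t₀ := fun t ht => ⟨by linarith [ht.1], ht.2⟩
  have cR : ContinuousOn M (Icc t₀ (t₀ + r)) :=
    hc.mono fun t ht => ⟨by linarith [ht.1], by linarith [ht.2]⟩
  have cL : ContinuousOn M (Icc (t₀ - r) t₀) :=
    hc.mono fun t ht => ⟨by linarith [ht.1], by linarith [ht.2]⟩
  have pR : 0 < M (t₀ + r) := h0 ▸ hR tR rR (by linarith)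
  have pL : 0 < M (t₀ - r) := h0 ▸ hL rL tL (by linarith)
  refine ⟨fun t ht => ?_, min (M (t₀ + r)) (M (t₀ - r)), lt_min pR pL, ?_⟩
  · rcases le_total t₀ t with h | h
    · exact h0 ▸ hR.monotoneOn tR ⟨h, ht.2⟩ h
    · exact h0 ▸ hL.antitoneOn ⟨ht.1, h⟩ tL h
  set d := min (M (t₀ + r)) (M (t₀ - r))
  obtain ⟨τ, hτc, hτ⟩ := exists_continuousOn_rightInverse (J := Ico 0 d) isCompact_Icc cR
    (hR.injOn.mono kR) (fun y hy => intermediate_value_Icc (by linarith) cR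
      ⟨by rw [h0]; exact hy.1, hy.2.le.trans (min_le_left _ _)⟩)
  obtain ⟨τ', hτc', hτ'⟩ := exists_continuousOn_rightInverse (J := Ico 0 d) isCompact_Icc cL
    (hL.injOn.mono kL) (fun y hy => intermediate_value_Icc' (by linarith) cL
      ⟨by rw [h0]; exact hy.1, hy.2.le.trans (min_le_right _ _)⟩)
  have m0 : (0 : ℝ) ∈ Ico 0 d := ⟨le_rfl, lt_min pR pL⟩
  refine ⟨τ, τ', hτc, hτc', hR.injOn (kR (hτ 0 m0).1) tR ((hτ 0 m0).2.trans h0.symm),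
    hL.injOn (kL (hτ' 0 m0).1) tL ((hτ' 0 m0).2.trans h0.symm), fun y hy =>
    ⟨(hτ y hy).1, (hτ' y hy).1, (hτ y hy).2, (hτ' y hy).2, fun t ht hty => ?_⟩⟩
  rcases le_total t₀ t with h | h
  · exact Or.inl (hR.injOn ⟨h, ht.2⟩ (kR (hτ y hy).1) (hty.trans (hτ y hy).2.symm))
  · exact Or.inr (hL.injOn ⟨ht.1, h⟩ (kL (hτ' y hy).1) (hty.trans (hτ' y hy).2.symm))

/-- An injective endomorphism of a finite-dimensional space is an isomorphism. -/
lemma exists_continuousLinearEquiv_of_injective {E : Type*} [NormedAddCommGroup E]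
    [NormedSpace ℝ E] [FiniteDimensional ℝ E] (B : E →L[ℝ] E) (h : ∀ z, B z = 0 → z = 0) :
    ∃ e : E ≃L[ℝ] E, (e : E →L[ℝ] E) = B := by
  refine ⟨(LinearEquiv.ofInjectiveEndo (B : E →ₗ[ℝ] E)
    ((injective_iff_map_eq_zero _).2 h)).toContinuousLinearEquiv, ?_⟩
  ext z
  rfl

/-! ### Nondegenerate folds are saddle-node bifurcations -/

lemma jac_eq_planarMap {f : ℝ × ℝ → ℝ → ℝ × ℝ} {u : ℝ × ℝ} {μ : ℝ} {A : Jet₁}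
    (hf : HasFDerivAt (Function.uncurry f) A (u, μ)) :
    jac f u μ = planarMap (A ((1, 0), 0)).1 (A ((0, 1), 0)).1 (A ((1, 0), 0)).2
      (A ((0, 1), 0)).2 := by
  rw [jac_eq_comp_inl hf.differentiableAt, hf.fderiv, eq_planarMap (A.comp _)]
  simp

lemma isCodimOneEquilibrium_of_isFoldJet {f : ℝ × ℝ → ℝ → ℝ × ℝ} {z : (ℝ × ℝ) × ℝ}
    (hf : ContDiffAt ℝ 2 (Function.uncurry f) z) (h0 : Function.uncurry f z = 0)
    (hdet : jetDet (fderiv ℝ (Function.uncurry f) z) = 0)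
    (hF : IsFoldJet (fderiv ℝ (Function.uncurry f) z)
      (fderiv ℝ (fderiv ℝ (Function.uncurry f)) z)) :
    IsCodimOneEquilibrium f z.1 z.2 (jetKer (fderiv ℝ (Function.uncurry f) z))
        (jetCoker (fderiv ℝ (Function.uncurry f) z)) ∧
      jetCoker (fderiv ℝ (Function.uncurry f) z) (deriv (fun μ => f z.1 μ) z.2) ≠ 0 := by
  have hd := hf.differentiableAt (by norm_num)
  set A := fderiv ℝ (Function.uncurry f) z with hA
  unfold jetDet at hdet
  constructor
  · refine isCodimOneEquilibrium_of_det_eq_zero h0 (jac_eq_planarMap hd.hasFDerivAt) hdet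
      hF.trace_ne ?_ ?_ ?_
    · rw [← hA]
      simp only [planarMap_apply, jetKer, Prod.mk_eq_zero]
      exact ⟨by ring, by linear_combination hdet⟩
    · rw [← hA]
      ext
      · simp; ring
      · simp; linear_combination hdet
    · rw [hess_eq_fderiv_fderiv hf]
      exact hF.quad_ne
  · have h1 : HasFDerivAt (fun μ : ℝ => (z.1, μ)) (ContinuousLinearMap.inr ℝ (ℝ × ℝ) ℝ) z.2 :=
      hasFDerivAt_prodMk_right z.1 z.2
    have h2 : HasFDerivAt (Function.uncurry f ∘ fun μ : ℝ => (z.1, μ)) _ z.2 :=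
      HasFDerivAt.comp z.2 (hd.hasFDerivAt : HasFDerivAt _ A (z.1, z.2)) h1
    change jetCoker A (deriv (Function.uncurry f ∘ fun μ : ℝ => (z.1, μ)) z.2) ≠ 0
    rw [h2.hasDerivAt.deriv]
    exact hF.speed_ne

/-- A `C²` planar family with a nondegenerate fold jet undergoes a saddle-node bifurcation. The
equilibria form a curve `γ(t)` in `(state) × (parameter)` space, with parameter `m(t)`;
differentiating `f(γ(t)) = 0` gives `det(γ(t)) = -m'(t) · speed(γ(t))`, while the derivative of
`det(γ(t))` at the fold is a nonzero multiple of the quadratic coefficient. Hence `m` has a strict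
extremum at the fold, where the determinant changes sign along `γ`. -/
theorem saddleNodeAt_of_isFoldJet {f : ℝ × ℝ → ℝ → ℝ × ℝ} {z₀ : (ℝ × ℝ) × ℝ}
    (hf : ContDiffAt ℝ 2 (Function.uncurry f) z₀) (h0 : Function.uncurry f z₀ = 0)
    (hdet : jetDet (fderiv ℝ (Function.uncurry f) z₀) = 0)
    (hF : IsFoldJet (fderiv ℝ (Function.uncurry f) z₀)
      (fderiv ℝ (fderiv ℝ (Function.uncurry f)) z₀)) :
    SaddleNodeAt f z₀.1 z₀.2 := by
  refine ⟨⟨_, _, isCodimOneEquilibrium_of_isFoldJet hf h0 hdet hF⟩, ?_⟩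
  set F := Function.uncurry f with hFdef
  obtain ⟨u₀, μ₀⟩ := z₀
  set t₀ := u₀.2 with ht₀
  set A : (ℝ × ℝ) × ℝ → Jet₁ := fderiv ℝ F with hA
  set T := fderiv ℝ A (u₀, μ₀) with hT
  have hA0 : ContDiffAt ℝ 1 A (u₀, μ₀) := hf.fderiv_right (by norm_num)
  have hT0 : HasFDerivAt A T (u₀, μ₀) := (hA0.differentiableAt (by norm_num)).hasFDerivAt
  have hdiff : ∀ᶠ z in 𝓝 (u₀, μ₀), HasFDerivAt F (A z) z :=
    (hf.eventually (by simp)).mono fun z hz => (hz.differentiableAt (by norm_num)).hasFDerivAt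
  -- The state coordinate `x₂` parametrizes the zero set of `F`.
  let Ψ : (ℝ × ℝ) × ℝ → (ℝ × ℝ) × ℝ := fun z => (F z, z.1.2)
  let π : (ℝ × ℝ) × ℝ →L[ℝ] ℝ :=
    (ContinuousLinearMap.snd ℝ ℝ ℝ).comp (ContinuousLinearMap.fst ℝ (ℝ × ℝ) ℝ)
  obtain ⟨e, he⟩ := exists_continuousLinearEquiv_of_injective ((A (u₀, μ₀)).prod π) (by
    intro z hz
    have h1 : A (u₀, μ₀) z = 0 := congrArg Prod.fst hz
    have h2 : z.1.2 = 0 := congrArg Prod.snd hz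
    rw [eq_smul_of_jet_eq_zero hF.entry_ne hdet hF.speed_ne h1, h2]
    simp)
  have hΨ2 : ContDiffAt ℝ 2 Ψ (u₀, μ₀) := hf.prodMk (by fun_prop)
  have hΨ : HasStrictFDerivAt Ψ (e : (ℝ × ℝ) × ℝ →L[ℝ] (ℝ × ℝ) × ℝ) (u₀, μ₀) := by
    refine hΨ2.hasStrictFDerivAt' ?_ (by norm_num)
    rw [he]
    exact hdiff.self_of_nhds.prodMk π.hasFDerivAt
  set G := hΨ.localInverse Ψ e (u₀, μ₀) with hG
  have hΨ0 : Ψ (u₀, μ₀) = ((0 : ℝ × ℝ), t₀) := Prod.ext h0 rfl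
  let γ : ℝ → (ℝ × ℝ) × ℝ := fun t => G ((0 : ℝ × ℝ), t)
  have hG2 : ContDiffAt ℝ 2 G ((0 : ℝ × ℝ), t₀) := by
    rw [← hΨ0]
    exact hΨ2.to_localInverse hΨ.hasFDerivAt (by norm_num)
  have hγ2 : ContDiffAt ℝ 2 γ t₀ := hG2.comp t₀ (by fun_prop)
  have hγ0 : γ t₀ = (u₀, μ₀) := by
    have := hΨ.localInverse_apply_image
    rwa [hΨ0] at this
  have hγc : Tendsto γ (𝓝 t₀) (𝓝 (u₀, μ₀)) := hγ0 ▸ hγ2.continuousAt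
  have hleft : ∀ᶠ z in 𝓝 (u₀, μ₀), F z = 0 → γ z.1.2 = z := by
    filter_upwards [hΨ.eventually_left_inverse] with z hz hz0
    have : Ψ z = ((0 : ℝ × ℝ), z.1.2) := Prod.ext hz0 rfl
    rw [this] at hz
    exact hz
  have hright : ∀ᶠ t in 𝓝 t₀, F (γ t) = 0 ∧ (γ t).1.2 = t := by
    have h1 : Tendsto (fun t : ℝ => ((0 : ℝ × ℝ), t)) (𝓝 t₀) (𝓝 (Ψ (u₀, μ₀))) := by
      rw [hΨ0]
      exact Continuous.tendsto (by fun_prop) t₀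
    filter_upwards [h1.eventually hΨ.eventually_right_inverse] with t ht
    exact ⟨congrArg Prod.fst ht, congrArg Prod.snd ht⟩
  have hγd : ∀ᶠ t in 𝓝 t₀, HasDerivAt γ (deriv γ t) t :=
    (hγ2.eventually (by simp)).mono fun t ht => (ht.differentiableAt (by norm_num)).hasDerivAt
  have htan : ∀ᶠ t in 𝓝 t₀, A (γ t) (deriv γ t) = 0 ∧ (deriv γ t).1.2 = 1 := by
    filter_upwards [hright.eventually_nhds, hγd, hγc.eventually hdiff] with t ht hd hFd
    constructor
    · have h1 : HasDerivAt (fun t => F (γ t)) (A (γ t) (deriv γ t)) t :=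
        hFd.comp_hasDerivAt t hd
      exact h1.unique ((hasDerivAt_const t (0 : ℝ × ℝ)).congr_of_eventuallyEq
        (ht.mono fun s hs => hs.1))
    · have h1 : HasDerivAt (fun t => π (γ t)) (π (deriv γ t)) t :=
        π.hasFDerivAt.comp_hasDerivAt t hd
      exact h1.unique ((hasDerivAt_id t).congr_of_eventuallyEq (ht.mono fun s hs => hs.2))
  have hkey : ∀ᶠ t in 𝓝 t₀,
      jetDet (A (γ t)) = -((deriv γ t).2 * jetSpeed (A (γ t))) := by
    filter_upwards [htan] with t ht
    have h1 := ht.1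
    rw [jet_apply, ht.2] at h1
    have h2 := congrArg Prod.fst h1
    have h3 := congrArg Prod.snd h1
    simp at h2 h3
    simp only [jetDet, jetSpeed, jetCoker_apply]
    linear_combination (A (γ t) ((1, 0), 0)).1 * h3 - (A (γ t) ((1, 0), 0)).2 * h2
  -- The determinant has a simple zero along the curve.
  have hγt0 : HasFDerivAt A T (γ t₀) := by rw [hγ0]; exact hT0
  have hD : HasDerivAt (fun t => jetDet (A (γ t)))
      (jetDetDeriv (A (u₀, μ₀)) (T (deriv γ t₀))) t₀ := by
    have h1 := hγt0.comp_hasDerivAt t₀ hγd.self_of_nhds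
    have h2 := (hasFDerivAt_jetDet (A (γ t₀))).comp_hasDerivAt t₀ h1
    rwa [hγ0] at h2
  set d := jetDetDeriv (A (u₀, μ₀)) (T (deriv γ t₀)) with hd
  have hdne : d ≠ 0 := by
    have h1 := htan.self_of_nhds
    rw [hγ0] at h1
    have h2 := eq_smul_of_jet_eq_zero hF.entry_ne hdet hF.speed_ne h1.1
    rw [h1.2] at h2
    have h3 := entry_mul_jetDetDeriv hdet (T (deriv γ t₀))
    intro h4
    rw [← hd, h4, mul_zero, h2] at h3
    simp only [map_smul, smul_apply] at h3
    rw [smul_eq_mul, eq_comm, mul_eq_zero] at h3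
    exact h3.elim (one_div_ne_zero hF.entry_ne) hF.quad_ne
  have hsign := eventually_mul_pos_of_hasDerivAt hD hdne (by simpa only [hγ0] using hdet)
  have hAc : Tendsto (fun t => A (γ t)) (𝓝 t₀) (𝓝 (A (u₀, μ₀))) :=
    hA0.continuousAt.tendsto.comp hγc
  have hspeed : ∀ᶠ t in 𝓝 t₀, 0 < jetSpeed (A (u₀, μ₀)) * jetSpeed (A (γ t)) :=
    (((continuous_jetSpeed.tendsto _).comp hAc).const_mul (jetSpeed (A (u₀, μ₀)))).eventually
      (lt_mem_nhds (mul_self_pos.2 hF.speed_ne))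
  have hdisc : ∀ᶠ t in 𝓝 t₀, 4 * jetDet (A (γ t)) < jetTrace (A (γ t)) ^ 2 := by
    have hc : Continuous fun B : Jet₁ => jetTrace B ^ 2 - 4 * jetDet B := by fun_prop
    have h1 : 0 < jetTrace (A (u₀, μ₀)) ^ 2 - 4 * jetDet (A (u₀, μ₀)) := by
      have := hF.trace_ne
      rw [hdet, mul_zero, sub_zero]
      exact sq_pos_of_ne_zero this
    filter_upwards [((hc.tendsto _).comp hAc).eventually (lt_mem_nhds h1)] with t ht
    exact sub_pos.1 ht
  -- The side of `μ₀` on which the equilibria exist.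
  obtain ⟨σ, hσ, hσpos⟩ : ∃ σ : ℝ, (σ = 1 ∨ σ = -1) ∧
      0 < σ * -(d * jetSpeed (A (u₀, μ₀))) := by
    rcases lt_or_gt_of_ne (mul_ne_zero hdne hF.speed_ne) with h | h
    · exact ⟨1, Or.inl rfl, by linarith⟩
    · exact ⟨-1, Or.inr rfl, by linarith⟩
  have hσ2 : σ * σ = 1 := by rcases hσ with h | h <;> rw [h] <;> norm_num
  let M : ℝ → ℝ := fun t => σ * ((γ t).2 - μ₀)
  have hMd : ∀ᶠ t in 𝓝 t₀, HasDerivAt M (σ * (deriv γ t).2) t := by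
    filter_upwards [hγd] with t ht
    exact (((ContinuousLinearMap.snd ℝ (ℝ × ℝ) ℝ).hasFDerivAt.comp_hasDerivAt t ht).sub_const
      μ₀).const_mul σ
  have hM' : ∀ᶠ t in 𝓝 t₀, t ≠ t₀ → 0 < σ * (deriv γ t).2 * (t - t₀) := by
    filter_upwards [hkey, hsign, hspeed] with t hk hs hsp hne
    have h1 := hs hne
    rw [hk] at h1
    have h2 : 0 < (σ * -(d * jetSpeed (A (u₀, μ₀)))) *
        ((jetSpeed (A (u₀, μ₀)) * jetSpeed (A (γ t))) *
          (d * -((deriv γ t).2 * jetSpeed (A (γ t))) * (t - t₀))) :=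
      mul_pos hσpos (mul_pos hsp h1)
    have h3 : (σ * (deriv γ t).2 * (t - t₀)) *
        (d * jetSpeed (A (u₀, μ₀)) * jetSpeed (A (γ t))) ^ 2 =
        (σ * -(d * jetSpeed (A (u₀, μ₀)))) * ((jetSpeed (A (u₀, μ₀)) * jetSpeed (A (γ t))) *
          (d * -((deriv γ t).2 * jetSpeed (A (γ t))) * (t - t₀))) := by ring
    rw [← h3] at h2
    exact pos_of_mul_pos_left h2 (sq_nonneg _)
  -- A uniform interval of the curve parameter.
  obtain ⟨ρ, hρ, hall⟩ := Metric.eventually_nhds_iff_ball.1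
    (hMd.and (hM'.and (hright.and (hsign.and (hdisc.and
      ((hγc.eventually hdiff).and hγd))))))
  rw [Real.ball_eq_Ioo] at hall
  obtain ⟨W, hW, hWo, hW0⟩ := eventually_nhds_iff.1 hleft
  obtain ⟨r₁, hr₁, hr₁W⟩ := Metric.isOpen_iff.1 hWo _ hW0
  set r₂ := min r₁ ρ with hr₂
  have hr₂pos : 0 < r₂ := lt_min hr₁ hρ
  have hζc : Tendsto (fun t => (γ t).1) (𝓝 t₀) (𝓝 u₀) :=
    (continuous_fst.tendsto (u₀, μ₀)).comp hγc
  obtain ⟨r₃, hr₃, hζ⟩ := Metric.eventually_nhds_iff_ball.1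
    (hζc.eventually (Metric.ball_mem_nhds u₀ hr₂pos))
  obtain ⟨r, hr, hrlt⟩ := exists_between (lt_min hr₃ hρ)
  have hrρ : r < ρ := hrlt.trans_le (min_le_right _ _)
  have hM0 : M t₀ = 0 := by simp [M, hγ0]
  obtain ⟨hMnn, δ₀, hδ₀, τ, τ', hτc, hτc', hτ0, hτ0', hτ⟩ := exists_fold_branches hr hrρ hM0
    (fun t ht => (hall t ht).1) (fun t ht => (hall t ht).2.1)
  -- The branch of positive determinant consists of nodes, the other one of saddles.
  obtain ⟨τs, τn, hsc, hnc, hs0, hn0, hsn⟩ : ∃ τs τn : ℝ → ℝ, ContinuousOn τs (Ico 0 δ₀) ∧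
      ContinuousOn τn (Ico 0 δ₀) ∧ τs 0 = t₀ ∧ τn 0 = t₀ ∧ ∀ y ∈ Ico 0 δ₀,
        τs y ∈ Icc (t₀ - r) (t₀ + r) ∧ τn y ∈ Icc (t₀ - r) (t₀ + r) ∧
        M (τs y) = y ∧ M (τn y) = y ∧
        (∀ t ∈ Ioo (t₀ - ρ) (t₀ + ρ), M t = y → t = τs y ∨ t = τn y) ∧
        (y ≠ 0 → d * (τs y - t₀) < 0 ∧ 0 < d * (τn y - t₀)) := by
    have hne : ∀ y ∈ Ico 0 δ₀, y ≠ 0 → t₀ < τ y ∧ τ' y < t₀ := by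
      intro y hy hy0
      obtain ⟨h1, h2, h3, h4, -⟩ := hτ y hy
      refine ⟨lt_of_le_of_ne h1.1 ?_, lt_of_le_of_ne h2.2 ?_⟩
      · intro h
        exact hy0 (by rw [← h3, ← h, hM0])
      · intro h
        exact hy0 (by rw [← h4, h, hM0])
    rcases lt_or_gt_of_ne hdne with hneg | hpos
    · refine ⟨τ, τ', hτc, hτc', hτ0, hτ0', fun y hy => ?_⟩
      obtain ⟨h1, h2, h3, h4, h5⟩ := hτ y hy
      refine ⟨⟨by linarith [h1.1], h1.2⟩, ⟨h2.1, by linarith [h2.2]⟩, h3, h4, h5, fun hy0 => ?_⟩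
      exact ⟨mul_neg_of_neg_of_pos hneg (sub_pos.2 (hne y hy hy0).1),
        mul_pos_of_neg_of_neg hneg (sub_neg.2 (hne y hy hy0).2)⟩
    · refine ⟨τ', τ, hτc', hτc, hτ0', hτ0, fun y hy => ?_⟩
      obtain ⟨h1, h2, h3, h4, h5⟩ := hτ y hy
      refine ⟨⟨h2.1, by linarith [h2.2]⟩, ⟨by linarith [h1.1], h1.2⟩, h4, h3,
        fun t ht hty => (h5 t ht hty).symm, fun hy0 => ?_⟩
      exact ⟨mul_neg_of_pos_of_neg hpos (sub_neg.2 (hne y hy hy0).2),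
        mul_pos hpos (sub_pos.2 (hne y hy hy0).1)⟩
  have hsub : Icc (t₀ - r) (t₀ + r) ⊆ Ioo (t₀ - ρ) (t₀ + ρ) := fun t ht =>
    ⟨by linarith [ht.1], by linarith [ht.2]⟩
  have hMeq : ∀ {t y}, M t = σ * (y - μ₀) → (γ t).2 = y := by
    intro t y h
    have : (γ t).2 - μ₀ = y - μ₀ := by
      have := congrArg (σ * ·) h
      simp only [M, ← mul_assoc, hσ2, one_mul] at this
      exact this
    linarith
  have hmem : ∀ {t}, t ∈ Icc (t₀ - r) (t₀ + r) → (γ t).1 ∈ Metric.ball u₀ r₂ := by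
    intro t ht
    refine hζ t ?_
    have hr3 : r < r₃ := hrlt.trans_le (min_le_left _ _)
    rw [Real.ball_eq_Ioo]
    exact ⟨by linarith [ht.1], by linarith [ht.2]⟩
  have hjac : ∀ t ∈ Ioo (t₀ - ρ) (t₀ + ρ), jac f (γ t).1 (γ t).2 =
      planarMap (A (γ t) ((1, 0), 0)).1 (A (γ t) ((0, 1), 0)).1 (A (γ t) ((1, 0), 0)).2
      (A (γ t) ((0, 1), 0)).2 := fun t ht => jac_eq_planarMap (hall t ht).2.2.2.2.2.1
  have hmaps : MapsTo (fun μ => σ * (μ - μ₀))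
      {μ | |μ - μ₀| < min δ₀ r₁ ∧ 0 ≤ σ * (μ - μ₀)} (Ico 0 δ₀) := by
    rintro μ ⟨h1, h2⟩
    refine ⟨h2, lt_of_le_of_lt (le_abs_self _) ?_⟩
    have : |σ| = 1 := by rcases hσ with h | h <;> simp [h]
    rw [abs_mul, this, one_mul]
    exact h1.trans_le (min_le_left _ _)
  have hcont : ∀ τ₁ : ℝ → ℝ, ContinuousOn τ₁ (Ico 0 δ₀) →
      (∀ y ∈ Ico 0 δ₀, τ₁ y ∈ Icc (t₀ - r) (t₀ + r)) →
      ContinuousOn (fun μ => (γ (τ₁ (σ * (μ - μ₀)))).1)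
        {μ | |μ - μ₀| < min δ₀ r₁ ∧ 0 ≤ σ * (μ - μ₀)} := by
    intro τ₁ hτ₁ hm
    have h1 : ContinuousOn (fun t => (γ t).1) (Icc (t₀ - r) (t₀ + r)) := fun t ht =>
      (continuous_fst.continuousAt.comp
        (hall t (hsub ht)).2.2.2.2.2.2.continuousAt).continuousWithinAt
    exact h1.comp (hτ₁.comp (by fun_prop) hmaps) fun μ hμ => hm _ (hmaps hμ)
  refine ⟨σ, hσ, Metric.ball u₀ r₂, min δ₀ r₁, fun μ => (γ (τs (σ * (μ - μ₀)))).1,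
    fun μ => (γ (τn (σ * (μ - μ₀)))).1, Metric.isOpen_ball, Metric.mem_ball_self hr₂pos,
    lt_min hδ₀ hr₁, by simp [hs0, hγ0], by simp [hn0, hγ0],
    hcont τs hsc fun y hy => (hsn y hy).1, hcont τn hnc fun y hy => (hsn y hy).2.1, ?_⟩
  intro μ hμ
  -- Every equilibrium in the neighbourhood lies on the curve.
  have hon : ∀ u ∈ Metric.ball u₀ r₂, f u μ = 0 →
      u.2 ∈ Ioo (t₀ - ρ) (t₀ + ρ) ∧ γ u.2 = (u, μ) ∧ M u.2 = σ * (μ - μ₀) := by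
    intro u hu hfu
    have hz : (u, μ) ∈ W := hr₁W (by
      rw [Metric.mem_ball, Prod.dist_eq]
      exact max_lt (lt_of_lt_of_le hu (min_le_left _ _)) (hμ.trans_le (min_le_right _ _)))
    have h1 : γ u.2 = (u, μ) := hW _ hz hfu
    refine ⟨?_, h1, by simp only [M, h1]⟩
    rw [← Real.ball_eq_Ioo, Metric.mem_ball]
    refine lt_of_le_of_lt ?_ (lt_of_lt_of_le hu (min_le_right r₁ ρ))
    rw [Prod.dist_eq]
    exact le_max_right _ _
  refine ⟨fun hneg => ?_, fun hnn => ?_, fun hpos => ?_⟩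
  · rw [eq_empty_iff_forall_notMem]
    rintro u ⟨hu, hfu⟩
    obtain ⟨h1, -, h3⟩ := hon u hu hfu
    linarith [hMnn _ h1]
  · have hy := hmaps ⟨hμ, hnn⟩
    obtain ⟨h1, h2, h3, h4, h5, -⟩ := hsn _ hy
    have hzero : ∀ t, t ∈ Icc (t₀ - r) (t₀ + r) → M t = σ * (μ - μ₀) →
        (γ t).1 ∈ Metric.ball u₀ r₂ ∧ f (γ t).1 μ = 0 := by
      intro t ht hMt
      refine ⟨hmem ht, ?_⟩
      rw [← hMeq hMt]
      exact (hall t (hsub ht)).2.2.1.1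
    ext u
    constructor
    · rintro ⟨hu, hfu⟩
      obtain ⟨g1, g2, g3⟩ := hon u hu hfu
      have g4 : u = (γ u.2).1 := by rw [g2]
      rcases h5 _ g1 g3 with h | h
      · left; rw [h] at g4; exact g4
      · right; rw [h] at g4; exact g4
    · rintro (rfl | rfl)
      · exact hzero _ h1 h3
      · exact hzero _ h2 h4
  · have hy := hmaps ⟨hμ, hpos.le⟩
    obtain ⟨h1, h2, h3, h4, -, h6⟩ := hsn _ hy
    obtain ⟨h7, h8⟩ := h6 hpos.ne'
    have hprod : ∀ t ∈ Ioo (t₀ - ρ) (t₀ + ρ), d * (t - t₀) ≠ 0 →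
        0 < jetDet (A (γ t)) * (d * (t - t₀)) := by
      intro t ht hne
      have := (hall t ht).2.2.2.1 fun h => hne (by rw [h, sub_self, mul_zero])
      linarith
    have hJs := hjac _ (hsub h1)
    have hJn := hjac _ (hsub h2)
    have hZs := (hall _ (hsub h1)).2.2.1.1
    have hZn := (hall _ (hsub h2)).2.2.1.1
    rw [hMeq h3] at hJs
    rw [hMeq h4] at hJn
    have hes : γ (τs (σ * (μ - μ₀))) = ((γ (τs (σ * (μ - μ₀)))).1, μ) :=
      Prod.ext rfl (hMeq h3)
    have hen : γ (τn (σ * (μ - μ₀))) = ((γ (τn (σ * (μ - μ₀)))).1, μ) :=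
      Prod.ext rfl (hMeq h4)
    constructor
    · refine isSaddle_of_det_neg ?_ hJs ?_
      · rw [hes] at hZs; exact hZs
      · exact (neg_iff_neg_of_mul_pos (hprod _ (hsub h1) h7.ne)).2 h7
    · refine isNode_of_det_pos ?_ hJn ?_ (hall _ (hsub h2)).2.2.2.2.1
      · rw [hen] at hZn; exact hZn
      · exact (pos_iff_pos_of_mul_pos (hprod _ (hsub h2) h8.ne')).2 h8

/-! ### Persistence of nondegenerate folds -/

/-- The derivative of `z ↦ (f z, det D_u f z)` as a function of the 2-jet of `f`. -/
def foldDeriv (A : Jet₁) (T : Jet₂) : (ℝ × ℝ) × ℝ →L[ℝ] (ℝ × ℝ) × ℝ :=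
  (ContinuousLinearMap.inl ℝ (ℝ × ℝ) ℝ).comp A
    + (ContinuousLinearMap.inr ℝ (ℝ × ℝ) ℝ).comp ((jetDetDeriv A).comp T)

lemma foldDeriv_apply (A : Jet₁) (T : Jet₂) (z : (ℝ × ℝ) × ℝ) :
    foldDeriv A T z = (A z, jetDetDeriv A (T z)) := by
  simp [foldDeriv]

lemma continuous_jetDetDeriv : Continuous jetDetDeriv := by
  have h1 : jetDetDeriv = fderiv ℝ jetDet := funext fun A => (hasFDerivAt_jetDet A).fderiv.symm
  have h2 : ContDiff ℝ 1 jetDet := by unfold jetDet; fun_prop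
  rw [h1]
  exact h2.continuous_fderiv (by norm_num)

lemma continuous_foldDeriv : Continuous fun p : Jet₁ × Jet₂ => foldDeriv p.1 p.2 := by
  have h1 : Continuous fun p : Jet₁ × Jet₂ => (jetDetDeriv p.1).comp p.2 :=
    (continuous_jetDetDeriv.comp continuous_fst).clm_comp continuous_snd
  exact (continuous_const.clm_comp continuous_fst).add (continuous_const.clm_comp h1)

lemma foldDeriv_injective {A : Jet₁} {T : Jet₂} (hF : IsFoldJet A T) (hdet : jetDet A = 0)
    (z : (ℝ × ℝ) × ℝ) (hz : foldDeriv A T z = 0) : z = 0 := by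
  rw [foldDeriv_apply] at hz
  have h1 : A z = 0 := congrArg Prod.fst hz
  have h2 : jetDetDeriv A (T z) = 0 := congrArg Prod.snd hz
  have h3 := eq_smul_of_jet_eq_zero hF.entry_ne hdet hF.speed_ne h1
  have h4 := entry_mul_jetDetDeriv hdet (T z)
  rw [h2, mul_zero, h3, map_smul, smul_apply, map_smul, smul_eq_mul, eq_comm, mul_eq_zero] at h4
  rw [h3, h4.resolve_right hF.quad_ne, zero_smul]

lemma hasFDerivAt_fold {F : (ℝ × ℝ) × ℝ → ℝ × ℝ} {z : (ℝ × ℝ) × ℝ} (hF : ContDiffAt ℝ 2 F z) :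
    HasFDerivAt (fun z => (F z, jetDet (fderiv ℝ F z)))
      (foldDeriv (fderiv ℝ F z) (fderiv ℝ (fderiv ℝ F) z)) z := by
  have h1 : ContDiffAt ℝ 1 (fderiv ℝ F) z := hF.fderiv_right (by norm_num)
  have h2 := (hF.differentiableAt (by norm_num)).hasFDerivAt.prodMk
    ((hasFDerivAt_jetDet (fderiv ℝ F z)).comp z (h1.differentiableAt (by norm_num)).hasFDerivAt)
  have h3 : foldDeriv (fderiv ℝ F z) (fderiv ℝ (fderiv ℝ F) z) = (fderiv ℝ F z).prod
      ((jetDetDeriv (fderiv ℝ F z)).comp (fderiv ℝ (fderiv ℝ F) z)) :=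
    ContinuousLinearMap.ext fun x => foldDeriv_apply _ _ x
  rw [h3]
  exact h2

/-- Nondegenerate folds persist under `C²`-small perturbations: the fold equations
`(f, det D_u f) = 0` have invertible derivative, and a `C²`-small perturbation of `f` changes this
map by little in `C¹`, so that the perturbed equations are still solvable nearby. -/
theorem isGenericAt_saddleNodeAt_of_isFoldJet {g : ℝ × ℝ → ℝ → ℝ × ℝ} {z₀ : (ℝ × ℝ) × ℝ}
    (hg : ContDiff ℝ 2 (Function.uncurry g)) (h0 : Function.uncurry g z₀ = 0)
    (hdet : jetDet (fderiv ℝ (Function.uncurry g) z₀) = 0)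
    (hF : IsFoldJet (fderiv ℝ (Function.uncurry g) z₀)
      (fderiv ℝ (fderiv ℝ (Function.uncurry g)) z₀)) {k : ℕ} (hk : 2 ≤ k) :
    IsGenericAt SaddleNodeAt k g z₀.1 z₀.2 := by
  intro V hV hzV
  set G := Function.uncurry g with hG
  set A₀ := fderiv ℝ G z₀ with hA₀
  set T₀ := fderiv ℝ (fderiv ℝ G) z₀ with hT₀
  obtain ⟨e, he⟩ := exists_continuousLinearEquiv_of_injective (foldDeriv A₀ T₀)
    (foldDeriv_injective hF hdet)
  set N := ‖(e.symm : (ℝ × ℝ) × ℝ →L[ℝ] (ℝ × ℝ) × ℝ)‖₊ with hN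
  have hNpos : 0 < N := e.nnnorm_symm_pos
  set c : NNReal := N⁻¹ / 2 with hc
  have hcpos : 0 < c := by positivity
  have hNc : ((N : ℝ)⁻¹ - c) = c := by
    rw [hc]; push_cast; ring
  -- A neighbourhood of the 2-jet on which everything is controlled.
  have hjet : ∀ᶠ p in 𝓝 (A₀, T₀), IsFoldJet p.1 p.2 ∧ ‖foldDeriv p.1 p.2 - e‖ < c := by
    refine (isOpen_isFoldJet.eventually_mem hF).and ?_
    have h1 : Continuous fun p : Jet₁ × Jet₂ =>
        ‖foldDeriv p.1 p.2 - (e : (ℝ × ℝ) × ℝ →L[ℝ] (ℝ × ℝ) × ℝ)‖ :=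
      (continuous_foldDeriv.sub continuous_const).norm
    refine (h1.tendsto (A₀, T₀)).eventually (gt_mem_nhds ?_)
    rw [he, sub_self, norm_zero]
    exact hcpos
  obtain ⟨r, hr, hjet⟩ := (Metric.eventually_nhds_iff (α := Jet₁ × Jet₂)).1 hjet
  have hcd1 : ContDiff ℝ 1 (fderiv ℝ G) := hg.fderiv_right (by norm_num)
  have hcont : Continuous fun z => (fderiv ℝ G z, fderiv ℝ (fderiv ℝ G) z) :=
    (hcd1.continuous).prodMk (hcd1.continuous_fderiv (by norm_num))
  have hnear : ∀ᶠ z in 𝓝 z₀,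
      z ∈ V ∧ dist (fderiv ℝ G z, fderiv ℝ (fderiv ℝ G) z) (A₀, T₀) < r / 2 :=
    (hV.eventually_mem hzV).and
      ((hcont.tendsto z₀).eventually
        (Metric.ball_mem_nhds (α := Jet₁ × Jet₂) (A₀, T₀) (half_pos hr)))
  obtain ⟨ρ, hρ, hnear⟩ := Metric.nhds_basis_closedBall.eventually_iff.1 hnear
  have hdetc : ∀ᶠ B in 𝓝 A₀, |jetDet B| < c * ρ := by
    refine (continuous_jetDet.abs.tendsto A₀).eventually (gt_mem_nhds ?_)
    rw [hdet, abs_zero]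
    positivity
  obtain ⟨r', hr', hdetc⟩ := Metric.eventually_nhds_iff.1 hdetc
  refine ⟨min (r / 2) (min r' (c * ρ)), by positivity, fun h hh hsmall => ?_⟩
  set δ := min (r / 2) (min r' (c * ρ)) with hδ
  set H := Function.uncurry h with hH
  have hH2 : ∀ z ∈ V, ContDiffAt ℝ 2 H z := fun z hz =>
    (hh.contDiffAt (hV.mem_nhds hz)).of_le (by exact_mod_cast hk)
  have hHd : ∀ z ∈ V, DifferentiableAt ℝ H z := fun z hz =>
    (hH2 z hz).differentiableAt (by norm_num)
  have hF2 : ∀ z ∈ V, ContDiffAt ℝ 2 (fun z => G z + H z) z := fun z hz =>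
    hg.contDiffAt.add (hH2 z hz)
  have hD1 : ∀ z ∈ V, fderiv ℝ (fun z => G z + H z) z = fderiv ℝ G z + fderiv ℝ H z :=
    fun z hz => fderiv_fun_add (hg.differentiable (by norm_num) z) (hHd z hz)
  have hD2 : ∀ z ∈ V, fderiv ℝ (fderiv ℝ fun z => G z + H z) z =
      fderiv ℝ (fderiv ℝ G) z + fderiv ℝ (fderiv ℝ H) z := by
    intro z hz
    have h1 : (fderiv ℝ fun z => G z + H z) =ᶠ[𝓝 z] fun z => fderiv ℝ G z + fderiv ℝ H z :=
      (hV.eventually_mem hz).mono hD1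
    rw [h1.fderiv_eq]
    exact fderiv_fun_add (hcd1.differentiable (by norm_num) z)
      (((hH2 z hz).fderiv_right (m := 1) (by norm_num)).differentiableAt (by norm_num))
  have hn0 : ∀ z ∈ V, ‖H z‖ < δ := fun z hz => by
    simpa using hsmall z hz 0 (Nat.zero_le _)
  have hn1 : ∀ z ∈ V, ‖fderiv ℝ H z‖ < δ := fun z hz => by
    have := hsmall z hz 1 (by omega)
    rwa [norm_iteratedFDeriv_one] at this
  have hn2 : ∀ z ∈ V, ‖fderiv ℝ (fderiv ℝ H) z‖ < δ := fun z hz => by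
    have := hsmall z hz 2 hk
    rwa [← norm_iteratedFDeriv_fderiv, norm_iteratedFDeriv_one] at this
  have hdist : ∀ z ∈ Metric.closedBall z₀ ρ,
      dist (fderiv ℝ (fun z => G z + H z) z, fderiv ℝ (fderiv ℝ fun z => G z + H z) z)
        (A₀, T₀) < r := by
    intro z hz
    obtain ⟨hzV', hz'⟩ := hnear hz
    have hδr : δ ≤ r / 2 := min_le_left _ _
    have h1 : dist (fderiv ℝ G z + fderiv ℝ H z) (fderiv ℝ G z) < δ := by
      simpa using hn1 z hzV'
    have h2 : dist (fderiv ℝ (fderiv ℝ G) z + fderiv ℝ (fderiv ℝ H) z)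
        (fderiv ℝ (fderiv ℝ G) z) < δ :=
      lt_of_eq_of_lt (dist_self_add_left (E := Jet₂) (fderiv ℝ (fderiv ℝ H) z)
        (fderiv ℝ (fderiv ℝ G) z)) (hn2 z hzV')
    rw [hD1 z hzV', hD2 z hzV']
    refine (dist_triangle _ (fderiv ℝ G z, fderiv ℝ (fderiv ℝ G) z) _).trans_lt ?_
    have h3 : dist (fderiv ℝ G z + fderiv ℝ H z,
        fderiv ℝ (fderiv ℝ G) z + fderiv ℝ (fderiv ℝ H) z)
        (fderiv ℝ G z, fderiv ℝ (fderiv ℝ G) z) < δ := max_lt h1 h2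
    linarith
  -- The perturbed fold map is close to linear, hence covers a definite ball.
  set Φ : (ℝ × ℝ) × ℝ → (ℝ × ℝ) × ℝ :=
    fun z => (G z + H z, jetDet (fderiv ℝ (fun z => G z + H z) z)) with hΦ
  have happrox : ApproximatesLinearOn Φ (e : (ℝ × ℝ) × ℝ →L[ℝ] (ℝ × ℝ) × ℝ)
      (Metric.closedBall z₀ ρ) c := by
    intro x hx y hy
    exact (convex_closedBall z₀ ρ).norm_image_sub_le_of_norm_hasFDerivWithin_le'
      (fun z hz => (hasFDerivAt_fold (hF2 z (hnear hz).1)).hasFDerivWithinAt)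
      (fun z hz => (hjet (hdist z hz)).2.le) hy hx
  have hsurj := happrox.surjOn_closedBall_of_nonlinearRightInverse e.toNonlinearRightInverse
    hρ.le Subset.rfl
  have hzero : (0 : (ℝ × ℝ) × ℝ) ∈ Metric.closedBall (Φ z₀)
      (((e.toNonlinearRightInverse.nnnorm : ℝ)⁻¹ - c) * ρ) := by
    have h1 : ((e.toNonlinearRightInverse.nnnorm : ℝ)⁻¹ - c) = c := hNc
    rw [h1, Metric.mem_closedBall_comm, mem_closedBall_zero_iff, Prod.norm_def, max_le_iff]
    constructor
    · simp only [hΦ, h0, zero_add]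
      exact (hn0 z₀ hzV).le.trans ((min_le_right _ _).trans (min_le_right _ _))
    · refine (hdetc ?_).le
      rw [hD1 z₀ hzV, dist_eq_norm, add_sub_cancel_left]
      exact (hn1 z₀ hzV).trans_le ((min_le_right _ _).trans (min_le_left _ _))
  obtain ⟨z, hz, hΦz⟩ := hsurj hzero
  have hzV' := (hnear hz).1
  exact ⟨z, hzV', saddleNodeAt_of_isFoldJet (f := fun u μ => g u μ + h u μ) (hF2 z hzV')
    (congrArg Prod.fst hΦz) (congrArg Prod.snd hΦz) (hjet (hdist z hz)).1⟩

/-! ### Derivatives along lines -/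

section Lines

variable {E F : Type*} [NormedAddCommGroup E] [NormedSpace ℝ E] [NormedAddCommGroup F]
  [NormedSpace ℝ F]

lemma hasDerivAt_comp_line {f : E → F} {z v : E} {t : ℝ}
    (hf : DifferentiableAt ℝ f (z + t • v)) :
    HasDerivAt (fun s : ℝ => f (z + s • v)) (fderiv ℝ f (z + t • v) v) t := by
  have h1 : HasDerivAt (fun s : ℝ => z + s • v) v t := by
    simpa using ((hasDerivAt_id t).smul_const v).const_add z
  exact hf.hasFDerivAt.comp_hasDerivAt t h1

lemma _root_.HasDerivAt.comp_mul_right {f : ℝ → ℝ} {f' c t : ℝ} (h : HasDerivAt f f' (t * c)) :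
    HasDerivAt (fun s => f (s * c)) (f' * c) t :=
  h.comp t (hasDerivAt_mul_const c)

lemma fderiv_apply_eq_of_hasDerivAt {f : E → F} {z v : E} {q : F} (hf : DifferentiableAt ℝ f z)
    (h : HasDerivAt (fun s : ℝ => f (z + s • v)) q 0) : fderiv ℝ f z v = q := by
  have h1 := hasDerivAt_comp_line (f := f) (z := z) (v := v) (t := 0) (by simpa using hf)
  simpa using h1.unique h

/-- The second derivative in the direction `(v, v)`, observed through a functional `ℓ`, is the
second derivative along a line. -/
lemma fderiv_fderiv_apply_eq_of_hasDerivAt {f : E → F} {z v : E} (hf : ContDiff ℝ 2 f)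
    (ℓ : F →L[ℝ] ℝ) {γ' : ℝ → ℝ} {q : ℝ}
    (h1 : ∀ t, HasDerivAt (fun s : ℝ => ℓ (f (z + s • v))) (γ' t) t)
    (h2 : HasDerivAt γ' q 0) : ℓ (fderiv ℝ (fderiv ℝ f) z v v) = q := by
  have h3 : ∀ t, γ' t = ℓ (fderiv ℝ f (z + t • v) v) := fun t =>
    (h1 t).unique (ℓ.hasFDerivAt.comp_hasDerivAt t
      (hasDerivAt_comp_line (hf.differentiable (by norm_num) _)))
  have h4 : Differentiable ℝ (fderiv ℝ f) :=
    (hf.fderiv_right (m := 1) (by norm_num)).differentiable (by norm_num)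
  have h5 := hasDerivAt_comp_line (z := z) (v := v) (t := 0) (h4 (z + (0 : ℝ) • v))
  have h6 := ℓ.hasFDerivAt.comp_hasDerivAt 0 (h5.clm_apply (hasDerivAt_const 0 v))
  have h7 : HasDerivAt γ' (ℓ (fderiv ℝ (fderiv ℝ f) (z + (0 : ℝ) • v) v v)) 0 := by
    rw [funext h3]
    simp only [map_zero, add_zero] at h6
    exact h6
  simpa using h7.unique h2

end Lines

/-! ### The regularized families -/

lemma IsSTTransition.hasDerivAt {φ : ℝ → ℝ} (h : IsSTTransition φ) (s : ℝ) :
    HasDerivAt φ (deriv φ s) s :=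
  (h.contDiff.differentiable (by norm_num) s).hasDerivAt

lemma IsSTTransition.contDiff_deriv {φ : ℝ → ℝ} (h : IsSTTransition φ) :
    ContDiff ℝ 1 (deriv φ) :=
  ((contDiff_succ_iff_deriv (n := 1)).1 h.contDiff).2.2

lemma IsSTTransition.hasDerivAt_deriv {φ : ℝ → ℝ} (h : IsSTTransition φ) (s : ℝ) :
    HasDerivAt (deriv φ) (deriv (deriv φ) s) s :=
  (h.contDiff_deriv.differentiable (by norm_num) s).hasDerivAt

lemma tildeFamily_regularize (U : Set (ℝ × ℝ)) (a b c₁ c₂ α : ℝ) (φ ψ : ℝ → ℝ)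
    (G : ℝ × ℝ → ℝ × ℝ) (ε η : ℝ) (u : ℝ × ℝ) :
    (tildeFamily U a b c₁ c₂ α).regularize φ ψ G ε η 0 u =
      (a * (φ (u.1 / ε) * ψ (u.2 / η)) - b * c₂ / 2 * u.1 * (1 + φ (u.1 / ε) * ψ (u.2 / η)),
        b * (φ (u.1 / ε) * ψ (u.2 / η)) + a / 2 * (α * (1 + φ (u.1 / ε) * ψ (u.2 / η))
          + c₁ * u.2 * (1 - φ (u.1 / ε) * ψ (u.2 / η)))) := by
  ext <;> simp [PiecewiseField.regularize, tildeFamily] <;> ring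

lemma hatFamily_regularize (U : Set (ℝ × ℝ)) (a b c₁ c₂ β : ℝ) (φ ψ : ℝ → ℝ)
    (G : ℝ × ℝ → ℝ × ℝ) (ε η : ℝ) (u : ℝ × ℝ) :
    (hatFamily U a b c₁ c₂ β).regularize φ ψ G ε η 0 u =
      (a * (φ (u.1 / ε) * ψ (u.2 / η))
          - b / 2 * (1 + φ (u.1 / ε) * ψ (u.2 / η)) * (c₁ * u.1 + c₂ * u.2),
        b * (φ (u.1 / ε) * ψ (u.2 / η)) + 1 / 2 * (1 + φ (u.1 / ε) * ψ (u.2 / η)) * (a * β)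
          + 1 / 2 * (1 - φ (u.1 / ε) * ψ (u.2 / η)) * u.2 ^ 2) := by
  ext <;> simp [PiecewiseField.regularize, hatFamily] <;> ring

lemma sign_mul_self {x : ℝ} (hx : x ≠ 0) : Real.sign x * Real.sign x = 1 := by
  rcases Real.sign_apply_eq_of_ne_zero x hx with h | h <;> rw [h] <;> norm_num

lemma eventually_one_add_mul_pos {s : ℝ} : ∀ᶠ α in 𝓝[≠] (0 : ℝ), 0 < 1 + s * α := by
  have : ContinuousAt (fun α : ℝ => 1 + s * α) 0 := by fun_prop
  exact (this.eventually (lt_mem_nhds (by norm_num))).filter_mono nhdsWithin_le_nhds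

lemma crossesB1_tildeFamily (U : Set (ℝ × ℝ)) {a b c₁ c₂ : ℝ} (ha : a * a = 1) (hb : b * b = 1)
    (hc₁ : c₁ ≠ 0) (hc₂ : c₂ ≠ 0) : CrossesB1 (tildeFamily U a b c₁ c₂) := by
  have hdet : (tildeFamily U a b c₁ c₂ 0).det = fun p : ℝ × ℝ =>
      c₂ * p.1 + c₁ * p.2 - a * b * c₁ * c₂ * (p.1 * p.2) := by
    ext p
    simp only [PiecewiseField.det, tildeFamily]
    linear_combination (c₁ * p.2) * ha + (c₂ * p.1) * hb
  have hd : DifferentiableAt ℝ (tildeFamily U a b c₁ c₂ 0).det 0 := by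
    rw [hdet]; fun_prop
  have ha0 : a ≠ 0 := by rintro rfl; simp at ha
  have hb0 : b ≠ 0 := by rintro rfl; simp at hb
  refine ⟨⟨?_, ?_, ?_, ?_, ?_⟩, ?_⟩
  · simpa [tildeFamily] using ha0
  · simpa [tildeFamily] using hb0
  · simp [hdet]
  · rw [PiecewiseField.detDx₁, fderiv_apply_eq_of_hasDerivAt (q := c₂) hd ?_]
    · exact hc₂
    · rw [hdet]
      simpa using (hasDerivAt_id (0 : ℝ)).const_mul c₂
  · rw [PiecewiseField.detDx₂, fderiv_apply_eq_of_hasDerivAt (q := c₁) hd ?_]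
    · exact hc₁
    · rw [hdet]
      simpa using (hasDerivAt_id (0 : ℝ)).const_mul c₁
  · filter_upwards [self_mem_nhdsWithin, eventually_one_add_mul_pos (s := a * b)] with α h1 h2
    refine ⟨?_, ?_, ?_⟩
    · simpa [tildeFamily] using ha0
    · simp [tildeFamily]; linarith
    · have : (tildeFamily U a b c₁ c₂ α).det 0 = α := by
        simp [PiecewiseField.det, tildeFamily]
        linear_combination α * ha
      rw [this]; exact h1

lemma crossesB1_hatFamily (U : Set (ℝ × ℝ)) {a b c₁ c₂ : ℝ} (ha : a * a = 1) (hb : b * b = 1)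
    (hc₁ : c₁ ≠ 0) (hc₂ : c₂ ≠ 0) : CrossesB1 (hatFamily U a b c₁ c₂) := by
  have hdet : (hatFamily U a b c₁ c₂ 0).det = fun p : ℝ × ℝ =>
      c₁ * p.1 + c₂ * p.2 + (a - b * c₁ * p.1 - b * c₂ * p.2) * p.2 ^ 2 := by
    ext p
    simp only [PiecewiseField.det, hatFamily]
    linear_combination (c₁ * p.1 + c₂ * p.2) * hb
  have hd : DifferentiableAt ℝ (hatFamily U a b c₁ c₂ 0).det 0 := by
    rw [hdet]; fun_prop
  have ha0 : a ≠ 0 := by rintro rfl; simp at ha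
  have hb0 : b ≠ 0 := by rintro rfl; simp at hb
  refine ⟨⟨?_, ?_, ?_, ?_, ?_⟩, ?_⟩
  · simpa [hatFamily] using ha0
  · simpa [hatFamily] using hb0
  · simp [hdet]
  · rw [PiecewiseField.detDx₁, fderiv_apply_eq_of_hasDerivAt (q := c₁) hd ?_]
    · exact hc₁
    · rw [hdet]
      simpa using (hasDerivAt_id (0 : ℝ)).const_mul c₁
  · rw [PiecewiseField.detDx₂, fderiv_apply_eq_of_hasDerivAt (q := c₂) hd ?_]
    · exact hc₂
    · rw [hdet]
      have h1 := ((hasDerivAt_id (0 : ℝ)).const_mul c₂).add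
        ((((hasDerivAt_id (0 : ℝ)).const_mul (b * c₂)).const_sub a).mul
          ((hasDerivAt_id (0 : ℝ)).pow 2))
      simp at h1 ⊢
      exact h1
  · filter_upwards [self_mem_nhdsWithin, eventually_one_add_mul_pos (s := a * b)] with α h1 h2
    refine ⟨?_, ?_, ?_⟩
    · simpa [hatFamily] using ha0
    · simp [hatFamily]; linarith
    · have : (hatFamily U a b c₁ c₂ α).det 0 = α := by
        simp [PiecewiseField.det, hatFamily]
        linear_combination α * ha
      rw [this]; exact h1

/-! ### The saddle-node family -/

section Hat

variable {φ ψ : ℝ → ℝ} {a b c₁ c₂ ε η : ℝ}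

lemma contDiff_hatFamily (hφ : IsSTTransition φ) (hψ : IsSTTransition ψ) (U : Set (ℝ × ℝ))
    (G : ℝ × ℝ → ℝ × ℝ) :
    ContDiff ℝ 2 (Function.uncurry fun u β =>
      (hatFamily U a b c₁ c₂ β).regularize φ ψ G ε η 0 u) := by
  have h1 := hφ.contDiff
  have h2 := hψ.contDiff
  simp only [hatFamily_regularize, Function.uncurry_def]
  fun_prop

/-- The jet of the regularized family at the origin is a nondegenerate fold as soon as
`εη < 2φ'(0)ψ'(0)`. -/
lemma isFoldJet_hatFamily (hφ : IsSTTransition φ) (hψ : IsSTTransition ψ) (hφ0 : φ 0 = 0)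
    (hψ0 : ψ 0 = 0) (U : Set (ℝ × ℝ)) (G : ℝ × ℝ → ℝ × ℝ) (ha : a * a = 1) (hb : b * b = 1)
    (hc₁ : c₁ * c₁ = 1) (hc₂ : c₂ * c₂ = 1) (hε : 0 < ε) (hη : 0 < η)
    (hεη : ε * η < 2 * (deriv φ 0 * deriv ψ 0)) :
    let g := Function.uncurry fun u β => (hatFamily U a b c₁ c₂ β).regularize φ ψ G ε η 0 u
    jetDet (fderiv ℝ g 0) = 0 ∧ IsFoldJet (fderiv ℝ g 0) (fderiv ℝ (fderiv ℝ g) 0) := by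
  intro g
  have hg : ContDiff ℝ 2 g := contDiff_hatFamily hφ hψ U G
  have hgd : DifferentiableAt ℝ g 0 := hg.differentiable (by norm_num) 0
  have hgeq : ∀ z, g z = _ := fun z => hatFamily_regularize U a b c₁ c₂ z.2 φ ψ G ε η z.1
  have e1 : fderiv ℝ g 0 ((1, 0), 0) = (-(b * c₁ / 2), 0) := by
    refine fderiv_apply_eq_of_hasDerivAt hgd ?_
    simp only [hgeq]
    have h1 := ((hasDerivAt_id (0 : ℝ)).const_mul (-(b * c₁ / 2))).prodMk
      (hasDerivAt_const (0 : ℝ) (0 : ℝ))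
    rw [mul_one] at h1
    refine h1.congr_of_eventuallyEq (Eventually.of_forall fun t => ?_)
    ext <;> simp [hψ0] ; ring
  have e2 : fderiv ℝ g 0 ((0, 1), 0) = (-(b * c₂ / 2), 0) := by
    refine fderiv_apply_eq_of_hasDerivAt hgd ?_
    simp only [hgeq]
    have h1 := ((hasDerivAt_id (0 : ℝ)).const_mul (-(b * c₂ / 2))).prodMk
      (((hasDerivAt_id (0 : ℝ)).pow 2).const_mul (1 / 2))
    simp only [id, mul_one, Nat.cast_ofNat, Nat.add_one_sub_one, pow_one, mul_zero] at h1
    refine h1.congr_of_eventuallyEq (Eventually.of_forall fun t => ?_)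
    ext <;> simp [hφ0] ; ring
  have e3 : fderiv ℝ g 0 ((0, 0), 1) = (0, a / 2) := by
    refine fderiv_apply_eq_of_hasDerivAt hgd ?_
    simp only [hgeq]
    have h1 := (hasDerivAt_const (0 : ℝ) (0 : ℝ)).prodMk
      ((hasDerivAt_id (0 : ℝ)).const_mul (a / 2))
    rw [mul_one] at h1
    refine h1.congr_of_eventuallyEq (Eventually.of_forall fun t => ?_)
    ext <;> simp [hφ0, hψ0] ; ring
  have e4 (v : ℝ × ℝ) : (fderiv ℝ (fderiv ℝ g) 0 (v, 0) (v, 0)).2 =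
      2 * b * (deriv φ 0 * (v.1 / ε)) * (deriv ψ 0 * (v.2 / η)) + v.2 ^ 2 := by
    have hp (t : ℝ) := (hφ.hasDerivAt (t * (v.1 / ε))).comp_mul_right
    have hq (t : ℝ) := (hψ.hasDerivAt (t * (v.2 / η))).comp_mul_right
    have hp' := (hφ.hasDerivAt_deriv (0 * (v.1 / ε))).comp_mul_right.mul_const (v.1 / ε)
    have hq' := (hψ.hasDerivAt_deriv (0 * (v.2 / η))).comp_mul_right.mul_const (v.2 / η)
    refine fderiv_fderiv_apply_eq_of_hasDerivAt hg (ContinuousLinearMap.snd ℝ ℝ ℝ)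
      (γ' := fun t => b * (deriv φ (t * (v.1 / ε)) * (v.1 / ε) * ψ (t * (v.2 / η))
          + φ (t * (v.1 / ε)) * (deriv ψ (t * (v.2 / η)) * (v.2 / η)))
        + 1 / 2 * (-(deriv φ (t * (v.1 / ε)) * (v.1 / ε) * ψ (t * (v.2 / η))
          + φ (t * (v.1 / ε)) * (deriv ψ (t * (v.2 / η)) * (v.2 / η))) * (t * v.2) ^ 2
        + (1 - φ (t * (v.1 / ε)) * ψ (t * (v.2 / η))) * (2 * (t * v.2) * v.2))) ?_ ?_
    · intro t
      have h1 := ((hp t).fun_mul (hq t)).const_mul b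
      have h2 := ((((hp t).fun_mul (hq t)).const_sub 1).fun_mul
        (((hasDerivAt_id' t).mul_const v.2).fun_pow 2)).const_mul (1 / 2)
      refine ((h1.fun_add h2).congr_of_eventuallyEq
        (Eventually.of_forall fun s => ?_)).congr_deriv ?_
      · simp [hgeq, mul_div_assoc]; ring
      · simp
    · have h1 := (hp'.fun_mul (hq 0)).fun_add ((hp 0).fun_mul hq')
      have h2 := ((hp 0).fun_mul (hq 0)).const_sub 1
      have h3 := (hasDerivAt_id' (0 : ℝ)).mul_const v.2
      have h4 := (h1.const_mul b).fun_add (((h1.fun_neg.fun_mul (h3.fun_pow 2)).fun_add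
        (h2.fun_mul ((h3.const_mul 2).mul_const v.2))).const_mul (1 / 2))
      refine h4.congr_deriv ?_
      simp [hφ0, hψ0]
      ring
  have hb0 : b ≠ 0 := by rintro rfl; simp at hb
  have ha0 : a ≠ 0 := by rintro rfl; simp at ha
  have hc0 : c₁ ≠ 0 := by rintro rfl; simp at hc₁
  have hm : -(b * c₁ / 2) ≠ 0 := by
    have := mul_ne_zero hb0 hc0
    exact neg_ne_zero.2 (div_ne_zero this two_ne_zero)
  refine ⟨?_, ?_, ?_, ?_, ?_⟩
  · simp [jetDet, e1, e2]
  · rw [e1]; exact hm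
  · simpa [jetTrace, e1, e2] using hm
  · have h1 : jetSpeed (fderiv ℝ g 0) = -(b * c₁ / 2) * (a / 2) := by
      simp only [jetSpeed, jetCoker_apply, e1, e3]; ring
    rw [h1]
    exact mul_ne_zero hm (div_ne_zero ha0 two_ne_zero)
  · have h1 : jetQuad (fderiv ℝ g 0) (fderiv ℝ (fderiv ℝ g) 0) = -(b * c₁ / 2) *
        (-(b * c₁ * c₂) / 2 * (deriv φ 0 * deriv ψ 0 / (ε * η)) + 1 / 4) := by
      simp only [jetQuad, jetCoker_apply, jetKer, e1, e2, e4]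
      field_simp
      linear_combination (-4 * b * c₁ * (ε * η) * (c₁ * c₁)) * hb +
        (-4 * b * c₁ * (ε * η)) * hc₁ + (8 * b * b * c₁ * c₁ * c₂ * deriv φ 0 * deriv ψ 0) * hb
    rw [h1]
    refine mul_ne_zero hm fun h2 => ?_
    have h3 : b * c₁ * c₂ * (2 * (deriv φ 0 * deriv ψ 0)) = ε * η := by
      field_simp at h2
      linear_combination (-1 / 2) * h2
    have h4 : (2 * (deriv φ 0 * deriv ψ 0)) ^ 2 = (ε * η) ^ 2 := by
      rw [← h3]
      linear_combination -((2 * (deriv φ 0 * deriv ψ 0)) ^ 2) *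
        (hb + b * b * hc₁ + b * b * c₁ * c₁ * hc₂)
    have h5 : 0 < ε * η := mul_pos hε hη
    nlinarith

end Hat

/-! ### Hadamard factorization and inverse functions on the line -/

/-- A `C²` function vanishing at `0` is `x` times a `C¹` function. -/
lemma exists_eq_mul_contDiff {f : ℝ → ℝ} (hf : ContDiff ℝ 2 f) (h0 : f 0 = 0) :
    ∃ K : ℝ → ℝ, ContDiff ℝ 1 K ∧ (∀ x, f x = x * K x) ∧ K 0 = deriv f 0 ∧
      deriv K 0 = deriv (deriv f) 0 / 2 := by
  have hf1 : ContDiff ℝ 1 (deriv f) := ((contDiff_succ_iff_deriv (n := 1)).1 hf).2.2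
  have hd (x : ℝ) : HasDerivAt f (deriv f x) x := (hf.differentiable (by norm_num) x).hasDerivAt
  have hd' (x : ℝ) : HasDerivAt (deriv f) (deriv (deriv f) x) x :=
    (hf1.differentiable (by norm_num) x).hasDerivAt
  have hc2 : Continuous (deriv (deriv f)) := hf1.continuous_deriv (by norm_num)
  set K' : ℝ → ℝ := Function.update (fun x => (x * deriv f x - f x) / x ^ 2) 0
    (deriv (deriv f) 0 / 2) with hK'
  have hlim : Tendsto (fun x => (x * deriv f x - f x) / x ^ 2) (𝓝[≠] 0)
      (𝓝 (deriv (deriv f) 0 / 2)) := by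
    refine HasDerivAt.lhopital_zero_nhdsNE (f' := fun x => x * deriv (deriv f) x)
      (g' := fun x => 2 * x) ?_ ?_ ?_ ?_ ?_ ?_
    · refine Eventually.of_forall fun x => ?_
      refine (((hasDerivAt_id' x).fun_mul (hd' x)).fun_sub (hd x)).congr_deriv ?_
      ring
    · refine Eventually.of_forall fun x => ?_
      simpa using hasDerivAt_pow 2 x
    · filter_upwards [self_mem_nhdsWithin] with x hx
      exact mul_ne_zero two_ne_zero hx
    · have : Continuous fun x => x * deriv f x - f x :=
        (continuous_id.mul hf1.continuous).sub hf.continuous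
      exact (this.tendsto' 0 0 (by simp [h0])).mono_left nhdsWithin_le_nhds
    · have : Continuous fun x : ℝ => x ^ 2 := by fun_prop
      exact (this.tendsto' 0 0 (by simp)).mono_left nhdsWithin_le_nhds
    · have h1 : Tendsto (fun x => deriv (deriv f) x / 2) (𝓝[≠] 0)
          (𝓝 (deriv (deriv f) 0 / 2)) :=
        ((hc2.div_const 2).tendsto 0).mono_left nhdsWithin_le_nhds
      refine h1.congr' ?_
      filter_upwards [self_mem_nhdsWithin] with x hx
      have hx : x ≠ 0 := hx
      field_simp
  have hK'0 : ContinuousAt K' 0 := continuousAt_update_same.2 hlim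
  have hder : ∀ x, x ≠ 0 → HasDerivAt (dslope f 0) (K' x) x := by
    intro x hx
    have h1 : HasDerivAt (fun x => f x / x) ((deriv f x * x - f x * 1) / x ^ 2) x :=
      (hd x).fun_div (hasDerivAt_id' x) hx
    have h2 : dslope f 0 =ᶠ[𝓝 x] fun x => f x / x := by
      filter_upwards [isOpen_ne.mem_nhds hx] with y hy
      rw [dslope_of_ne _ hy, slope_def_field, h0, sub_zero, sub_zero]
    refine (h1.congr_of_eventuallyEq h2).congr_deriv ?_
    rw [hK', Function.update_of_ne hx]
    ring
  have hder0 : HasDerivAt (dslope f 0) (K' 0) 0 :=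
    hasDerivAt_of_hasDerivAt_of_ne hder
      (continuousAt_dslope_same.2 (hd 0).differentiableAt) hK'0
  have hall : ∀ x, HasDerivAt (dslope f 0) (K' x) x := fun x => by
    by_cases hx : x = 0
    · rw [hx]; exact hder0
    · exact hder x hx
  have hcont : Continuous K' := by
    refine continuous_iff_continuousAt.2 fun x => ?_
    by_cases hx : x = 0
    · rw [hx]; exact hK'0
    · refine (continuousAt_update_of_ne hx).2 ?_
      exact ((continuousAt_id.mul hf1.continuous.continuousAt).sub
        hf.continuous.continuousAt).div (by fun_prop) (pow_ne_zero 2 hx)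
  refine ⟨dslope f 0, ?_, fun x => ?_, dslope_same f 0, ?_⟩
  · rw [contDiff_one_iff_deriv]
    exact ⟨fun x => (hall x).differentiableAt, by rwa [funext fun x => (hall x).deriv]⟩
  · have := sub_smul_dslope f 0 x
    rw [h0, sub_zero, sub_zero, smul_eq_mul] at this
    exact this.symm
  · rw [hder0.deriv, hK', Function.update_self]

/-- The inverse function theorem on the real line, in class `C¹`. -/
lemma exists_localInverse {f : ℝ → ℝ} {x₀ d : ℝ} (hf : ContDiffAt ℝ 1 f x₀)
    (hd : HasDerivAt f d x₀) (hne : d ≠ 0) :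
    ∃ g : ℝ → ℝ, ContDiffAt ℝ 1 g (f x₀) ∧ g (f x₀) = x₀ ∧ HasDerivAt g d⁻¹ (f x₀) ∧
      (∀ᶠ x in 𝓝 x₀, g (f x) = x) ∧ ∀ᶠ y in 𝓝 (f x₀), f (g y) = y := by
  have hs : HasStrictFDerivAt f
      (ContinuousLinearEquiv.unitsEquivAut ℝ (Units.mk0 d hne) : ℝ →L[ℝ] ℝ) x₀ :=
    (hf.hasStrictDerivAt' hd (by norm_num)).hasStrictFDerivAt_equiv hne
  refine ⟨hs.localInverse f _ x₀, hf.to_localInverse hs.hasFDerivAt (by norm_num),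
    hs.localInverse_apply_image, ?_, hs.eventually_left_inverse, hs.eventually_right_inverse⟩
  exact ((hf.hasStrictDerivAt' hd (by norm_num)).to_localInverse hne).hasDerivAt

lemma continuousAt_deriv_of_contDiffAt {f : ℝ → ℝ} {x : ℝ} (hf : ContDiffAt ℝ 1 f x) :
    ContinuousAt (deriv f) x := by
  have h1 : ContinuousAt (fderiv ℝ f) x :=
    (hf.fderiv_right (m := 0) (by norm_num)).continuousAt
  exact h1.clm_apply continuousAt_const

/-! ### Transcritical points and their tangents -/

/-- The two branches of equilibria through a transcritical point give two independent directions
in the kernel of the full derivative of the family. -/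
lemma TranscriticalAt.exists_tangents {f : ℝ × ℝ → ℝ → ℝ × ℝ} {u : ℝ × ℝ} {μ : ℝ}
    (h : TranscriticalAt f u μ) (hd : DifferentiableAt ℝ (Function.uncurry f) (u, μ)) :
    f u μ = 0 ∧ ∃ v w : ℝ × ℝ, v ≠ w ∧ fderiv ℝ (Function.uncurry f) (u, μ) (v, 1) = 0 ∧
      fderiv ℝ (Function.uncurry f) (u, μ) (w, 1) = 0 := by
  obtain ⟨p, rfl, ⟨v, w, hvw, -⟩, N, δ, q, -, -, hδ, hqp, hpc, hqc, hne, hset, -⟩ := h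
  have hmem : Ioo (μ - δ) (μ + δ) ∈ 𝓝 μ := Ioo_mem_nhds (by linarith) (by linarith)
  have htan : ∀ r : ℝ → ℝ × ℝ, r μ = p μ → ContDiffOn ℝ 1 r (Ioo (μ - δ) (μ + δ)) →
      (∀ t ∈ Ioo (μ - δ) (μ + δ), f (r t) t = 0) →
      fderiv ℝ (Function.uncurry f) (p μ, μ) (deriv r μ, 1) = 0 := by
    intro r hr hrc hr0
    have h1 : HasDerivAt r (deriv r μ) μ :=
      ((hrc.contDiffAt hmem).differentiableAt (by norm_num)).hasDerivAt
    have h2 : HasFDerivAt (Function.uncurry f) (fderiv ℝ (Function.uncurry f) (p μ, μ))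
        (r μ, μ) := by rw [hr]; exact hd.hasFDerivAt
    have h3 : HasDerivAt (fun t => Function.uncurry f (r t, t))
        (fderiv ℝ (Function.uncurry f) (p μ, μ) (deriv r μ, 1)) μ :=
      HasFDerivAt.comp_hasDerivAt (f := fun t => (r t, t)) μ h2 (h1.prodMk (hasDerivAt_id' μ))
    refine h3.unique ((hasDerivAt_const μ (0 : ℝ × ℝ)).congr_of_eventuallyEq ?_)
    filter_upwards [hmem] with t ht
    exact hr0 t ht
  refine ⟨hvw.1, deriv p μ, deriv q μ, hne, htan p rfl hpc fun t ht => ?_,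
    htan q hqp hqc fun t ht => ?_⟩
  · have : p t ∈ {u ∈ N | f u t = 0} := by rw [hset t ht]; exact Or.inl rfl
    exact this.2
  · have : q t ∈ {u ∈ N | f u t = 0} := by rw [hset t ht]; exact Or.inr rfl
    exact this.2

/-! ### Transition functions -/

lemma IsSTTransition.apply_one {φ : ℝ → ℝ} (h : IsSTTransition φ) : φ 1 = 1 := by
  rw [h.eq_sign 1 (by norm_num), Real.sign_one]

lemma IsSTTransition.apply_neg_one {φ : ℝ → ℝ} (h : IsSTTransition φ) : φ (-1) = -1 := by
  rw [h.eq_sign (-1) (by norm_num), Real.sign_neg, Real.sign_one]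

lemma IsSTTransition.strictMonoOn {φ : ℝ → ℝ} (h : IsSTTransition φ) :
    StrictMonoOn φ (Icc (-1) 1) := by
  refine strictMonoOn_of_deriv_pos (convex_Icc _ _) h.contDiff.continuous.continuousOn
    fun t ht => ?_
  rw [interior_Icc] at ht
  exact h.deriv_pos t (abs_lt.2 ht)

lemma IsSTTransition.abs_lt_one {φ : ℝ → ℝ} (h : IsSTTransition φ) {t : ℝ} (ht : |t| < 1) :
    |φ t| < 1 := by
  rw [abs_lt] at ht ⊢
  have h1 := h.strictMonoOn (left_mem_Icc.2 (by norm_num)) ⟨ht.1.le, ht.2.le⟩ ht.1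
  have h2 := h.strictMonoOn ⟨ht.1.le, ht.2.le⟩ (right_mem_Icc.2 (by norm_num)) ht.2
  rw [h.apply_neg_one] at h1
  rw [h.apply_one] at h2
  exact ⟨h1, h2⟩

lemma IsSTTransition.exists_apply_eq {φ : ℝ → ℝ} (h : IsSTTransition φ) {y : ℝ} (hy : |y| < 1) :
    ∃ t, |t| < 1 ∧ φ t = y := by
  rw [abs_lt] at hy
  obtain ⟨t, ht, rfl⟩ := intermediate_value_Ioo (by norm_num : (-1 : ℝ) ≤ 1)
    h.contDiff.continuous.continuousOn
    (by rw [h.apply_neg_one, h.apply_one]; exact hy)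
  exact ⟨t, abs_lt.2 ht, rfl⟩

/-! ### The transcritical family: first derivatives -/

section Tilde

variable {φ ψ : ℝ → ℝ} {a b c₁ c₂ ε η : ℝ}

lemma contDiff_tildeFamily (hφ : IsSTTransition φ) (hψ : IsSTTransition ψ) (U : Set (ℝ × ℝ))
    (G : ℝ × ℝ → ℝ × ℝ) :
    ContDiff ℝ 2 (Function.uncurry fun u α =>
      (tildeFamily U a b c₁ c₂ α).regularize φ ψ G ε η 0 u) := by
  have h1 := hφ.contDiff
  have h2 := hψ.contDiff
  simp only [tildeFamily_regularize, Function.uncurry_def]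
  fun_prop

lemma hasDerivAt_transition_line (hφ : IsSTTransition φ) (x ε : ℝ) :
    HasDerivAt (fun t => φ ((x + t) / ε)) (deriv φ (x / ε) / ε) 0 := by
  have h1 : HasDerivAt (fun t : ℝ => (x + t) / ε) (1 / ε) 0 :=
    ((hasDerivAt_id' (0 : ℝ)).const_add x).div_const ε
  have h2 : HasDerivAt φ (deriv φ (x / ε)) ((x + 0) / ε) := by
    rw [add_zero]; exact hφ.hasDerivAt _
  exact (h2.comp 0 h1).congr_deriv (by ring)

lemma fderiv_tildeFamily (hφ : IsSTTransition φ) (hψ : IsSTTransition ψ) (U : Set (ℝ × ℝ))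
    (G : ℝ × ℝ → ℝ × ℝ) (x y α : ℝ) :
    let g := Function.uncurry fun u α => (tildeFamily U a b c₁ c₂ α).regularize φ ψ G ε η 0 u
    fderiv ℝ g ((x, y), α) ((1, 0), 0) =
        (deriv φ (x / ε) / ε * ψ (y / η) * (a - b * c₂ / 2 * x)
            - b * c₂ / 2 * (1 + φ (x / ε) * ψ (y / η)),
          deriv φ (x / ε) / ε * ψ (y / η) * (b + a / 2 * (α - c₁ * y))) ∧
      fderiv ℝ g ((x, y), α) ((0, 1), 0) =
        (φ (x / ε) * (deriv ψ (y / η) / η) * (a - b * c₂ / 2 * x),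
          φ (x / ε) * (deriv ψ (y / η) / η) * (b + a / 2 * (α - c₁ * y))
            + a / 2 * c₁ * (1 - φ (x / ε) * ψ (y / η))) ∧
      fderiv ℝ g ((x, y), α) ((0, 0), 1) = (0, a / 2 * (1 + φ (x / ε) * ψ (y / η))) := by
  intro g
  have hg : ContDiff ℝ 2 g := contDiff_tildeFamily hφ hψ U G
  have hgd : DifferentiableAt ℝ g ((x, y), α) := hg.differentiable (by norm_num) _
  have hgeq : ∀ z, g z = _ := fun z => tildeFamily_regularize U a b c₁ c₂ z.2 φ ψ G ε η z.1
  have hP := hasDerivAt_transition_line hφ x ε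
  have hR := hasDerivAt_transition_line hψ y η
  refine ⟨fderiv_apply_eq_of_hasDerivAt hgd ?_, fderiv_apply_eq_of_hasDerivAt hgd ?_,
    fderiv_apply_eq_of_hasDerivAt hgd ?_⟩
  · have h1 := hP.mul_const (ψ (y / η))
    have h2 := (h1.const_mul a).fun_sub ((((hasDerivAt_id' (0 : ℝ)).const_add x).const_mul
      (b * c₂ / 2)).fun_mul (h1.const_add 1))
    have h3 := (h1.const_mul b).fun_add ((((h1.const_add 1).const_mul α).fun_add
      ((h1.const_sub 1).const_mul (c₁ * y))).const_mul (a / 2))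
    refine ((h2.prodMk h3).congr_of_eventuallyEq (Eventually.of_forall fun t => ?_)).congr_deriv ?_
    · simp [hgeq]
    · ext <;> simp <;> ring
  · have h1 := hR.const_mul (φ (x / ε))
    have h2 := (h1.const_mul a).fun_sub ((h1.const_add 1).const_mul (b * c₂ / 2 * x))
    have h3 := (h1.const_mul b).fun_add ((((h1.const_add 1).const_mul α).fun_add
      ((((hasDerivAt_id' (0 : ℝ)).const_add y).const_mul c₁).fun_mul
        (h1.const_sub 1))).const_mul (a / 2))
    refine ((h2.prodMk h3).congr_of_eventuallyEq (Eventually.of_forall fun t => ?_)).congr_deriv ?_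
    · simp [hgeq]
    · ext <;> simp <;> ring
  · have h2 := hasDerivAt_const (0 : ℝ) (a * (φ (x / ε) * ψ (y / η))
      - b * c₂ / 2 * x * (1 + φ (x / ε) * ψ (y / η)))
    have h3 := (((((hasDerivAt_id' (0 : ℝ)).const_add α).mul_const
      (1 + φ (x / ε) * ψ (y / η))).add_const
        (c₁ * y * (1 - φ (x / ε) * ψ (y / η)))).const_mul (a / 2)).const_add
          (b * (φ (x / ε) * ψ (y / η)))
    refine ((h2.prodMk h3).congr_of_eventuallyEq (Eventually.of_forall fun t => ?_)).congr_deriv ?_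
    · simp [hgeq]
    · ext <;> simp

/-! ### The transcritical bifurcation is destroyed by a constant perturbation -/

/-- Adding a constant `(e, 0)` destroys all transcritical points. The first component `F₁` of the
family does not depend on the parameter, while the second one does; at a transcritical point of
the perturbed family `∂F₁/∂x₂` thus vanishes, which forces `x₁ = 0`. But there the first component
of the perturbed family is `e ≠ 0`. -/
theorem not_isGenericAt_transcriticalAt_tildeFamily (hφ : IsSTTransition φ)
    (hψ : IsSTTransition ψ) (hφ0 : φ 0 = 0) (U : Set (ℝ × ℝ)) (G : ℝ × ℝ → ℝ × ℝ)
    (ha : a * a = 1) (hb : b * b = 1) (hc₂ : c₂ * c₂ = 1) (hε : 0 < ε) (hη : 0 < η) {y₀ α₀ : ℝ}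
    (hy₀ : |y₀| < η) (k : ℕ) :
    ¬ IsGenericAt TranscriticalAt k
      (fun u α => (tildeFamily U a b c₁ c₂ α).regularize φ ψ G ε η 0 u) (0, y₀) α₀ := by
  intro hgen
  set V : Set ((ℝ × ℝ) × ℝ) := {z | |z.1.1| < ε ∧ |z.1.1| < 1 ∧ |z.1.2| < η} with hV
  have hVo : IsOpen V := by
    have h1 : IsOpen {z : (ℝ × ℝ) × ℝ | |z.1.1| < ε} := isOpen_lt (by fun_prop) (by fun_prop)
    have h2 : IsOpen {z : (ℝ × ℝ) × ℝ | |z.1.1| < 1} := isOpen_lt (by fun_prop) (by fun_prop)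
    have h3 : IsOpen {z : (ℝ × ℝ) × ℝ | |z.1.2| < η} := isOpen_lt (by fun_prop) (by fun_prop)
    exact h1.inter (h2.inter h3)
  obtain ⟨δ, hδ, hh⟩ := hgen V hVo ⟨by simpa using hε, by simp, hy₀⟩
  obtain ⟨⟨⟨x, y⟩, α⟩, hz, hB⟩ := hh (fun _ _ => (δ / 2, 0))
    (by exact contDiff_const.contDiffOn) (by
      intro z _ j _
      have hc : Function.uncurry (fun (_ : ℝ × ℝ) (_ : ℝ) => ((δ / 2, 0) : ℝ × ℝ)) =
        fun _ => (δ / 2, 0) := rfl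
      rw [hc]
      rcases Nat.eq_zero_or_pos j with rfl | hj
      · rw [norm_iteratedFDeriv_zero, Prod.norm_def]
        simp [abs_of_pos hδ, hδ]
      · rw [iteratedFDeriv_const_of_ne hj.ne']
        simpa using hδ)
  obtain ⟨hxε, hx1, hyη⟩ : |x| < ε ∧ |x| < 1 ∧ |y| < η := hz
  set g := Function.uncurry fun u α => (tildeFamily U a b c₁ c₂ α).regularize φ ψ G ε η 0 u
    with hg
  have hgd : DifferentiableAt ℝ g ((x, y), α) :=
    (contDiff_tildeFamily hφ hψ U G).differentiable (by norm_num) _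
  obtain ⟨h0, v, w, hvw, hv, hw⟩ := hB.exists_tangents (hgd.add_const (δ / 2, 0))
  have hfd : fderiv ℝ (Function.uncurry fun u α =>
      (tildeFamily U a b c₁ c₂ α).regularize φ ψ G ε η 0 u + (δ / 2, 0)) ((x, y), α) =
      fderiv ℝ g ((x, y), α) := fderiv_add_const (f := g) _
  obtain ⟨e1, e2, e3⟩ := fderiv_tildeFamily (a := a) (b := b) (c₁ := c₁) (c₂ := c₂) (ε := ε)
    (η := η) hφ hψ U G x y α
  have hxε' : |x / ε| < 1 := by rw [abs_div, abs_of_pos hε, div_lt_one hε]; exact hxε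
  have hyη' : |y / η| < 1 := by rw [abs_div, abs_of_pos hη, div_lt_one hη]; exact hyη
  have hP := abs_lt.1 (hφ.abs_lt_one hxε')
  have hR := abs_lt.1 (hψ.abs_lt_one hyη')
  have hpos : 0 < 1 + φ (x / ε) * ψ (y / η) := by nlinarith
  have ha0 : a ≠ 0 := by rintro rfl; simp at ha
  have hf2 : a / 2 * (1 + φ (x / ε) * ψ (y / η)) ≠ 0 :=
    mul_ne_zero (div_ne_zero ha0 two_ne_zero) hpos.ne'
  rw [hfd, jet_apply] at hv hw
  simp only [hg, e1, e2, e3] at hv hw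
  have hv1 := congrArg Prod.fst hv
  have hv2 := congrArg Prod.snd hv
  have hw1 := congrArg Prod.fst hw
  have hw2 := congrArg Prod.snd hw
  simp only [Prod.smul_mk, smul_eq_mul, Prod.mk_add_mk, Prod.fst_zero, Prod.snd_zero, one_mul,
    mul_zero, add_zero] at hv1 hv2 hw1 hw2
  generalize deriv φ (x / ε) / ε * ψ (y / η) * (a - b * c₂ / 2 * x)
            - b * c₂ / 2 * (1 + φ (x / ε) * ψ (y / η)) = m₁₁ at *
  generalize deriv φ (x / ε) / ε * ψ (y / η) * (b + a / 2 * (α - c₁ * y)) = m₂₁ at *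
  generalize φ (x / ε) * (deriv ψ (y / η) / η) * (b + a / 2 * (α - c₁ * y))
            + a / 2 * c₁ * (1 - φ (x / ε) * ψ (y / η)) = m₂₂ at *
  have hm : φ (x / ε) * (deriv ψ (y / η) / η) * (a - b * c₂ / 2 * x) = 0 := by
    generalize φ (x / ε) * (deriv ψ (y / η) / η) * (a - b * c₂ / 2 * x) = m₁₂ at *
    generalize a / 2 * (1 + φ (x / ε) * ψ (y / η)) = f₂ at *
    by_contra hm
    have h1 : v.1 * w.2 - v.2 * w.1 = 0 := by
      refine (mul_eq_zero.1 (?_ : m₁₂ * (v.1 * w.2 - v.2 * w.1) = 0)).resolve_left hm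
      linear_combination v.1 * hw1 - w.1 * hv1
    have h2 : f₂ * (v.1 - w.1) = 0 := by
      linear_combination v.1 * hw2 - w.1 * hv2 - m₂₂ * h1
    have h3 : f₂ * (v.2 - w.2) = 0 := by
      linear_combination v.2 * hw2 - w.2 * hv2 + m₂₁ * h1
    exact hvw (Prod.ext (sub_eq_zero.1 ((mul_eq_zero.1 h2).resolve_left hf2))
      (sub_eq_zero.1 ((mul_eq_zero.1 h3).resolve_left hf2)))
  have hfac : a - b * c₂ / 2 * x ≠ 0 := by
    intro h
    have hbc : (b * c₂ * x) ^ 2 = x ^ 2 := by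
      linear_combination (x ^ 2 * c₂ * c₂) * hb + x ^ 2 * hc₂
    have h4 : 4 = x ^ 2 := by
      rw [← hbc]
      linear_combination (-4) * ha + (4 * a + 2 * b * c₂ * x) * h
    have h5 : x ^ 2 < 1 := (sq_lt_one_iff_abs_lt_one x).2 hx1
    linarith
  have hφx : φ (x / ε) = 0 := by
    have h1 := (mul_eq_zero.1 hm).resolve_right hfac
    exact (mul_eq_zero.1 h1).resolve_right (div_pos (hψ.deriv_pos _ hyη') hη).ne'
  have hx0 : x = 0 := by
    have h1 : x / ε = 0 := hφ.strictMonoOn.injOn (abs_le.1 hxε'.le) ⟨by norm_num, by norm_num⟩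
      (by rw [hφx, hφ0])
    exact (div_eq_zero_iff.1 h1).resolve_right hε.ne'
  dsimp only at h0
  rw [tildeFamily_regularize] at h0
  have h1 := congrArg Prod.fst h0
  simp [hx0, hφ0] at h1
  exact hδ.ne' h1

end Tilde

/-! ### The transcritical family: codimension-one equilibrium -/

section Tilde

variable {φ ψ : ℝ → ℝ} {a b c₁ c₂ ε η s : ℝ}

lemma hasDerivAt_comp_affine {f : ℝ → ℝ} {f' x c ε t : ℝ}
    (h : HasDerivAt f f' ((x + t * c) / ε)) :
    HasDerivAt (fun t => f ((x + t * c) / ε)) (f' * (c / ε)) t :=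
  h.comp t (((hasDerivAt_mul_const c).const_add x).div_const ε)

/-- The coefficient governing the transversality of the two branches of equilibria: up to a nonzero
factor it is the quadratic coefficient at the bifurcation, and it is minus the derivative of the
parameter along the second branch, parametrized by `x₁`. -/
def branchCoeff (φ ψ : ℝ → ℝ) (a b c₁ c₂ ε η s : ℝ) : ℝ :=
  c₂ * (1 + a * b * (-c₁ * (η * s))) + c₁ * (η / deriv ψ s) *
    ((ε * deriv φ 0 - a * b * c₂ * deriv (deriv φ) 0) / (4 * deriv φ 0 ^ 2))

/-- At the crossing of the two branches the first row of the Jacobian vanishes, so that the first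
coordinate is a left null vector. -/
lemma isCodimOneEquilibrium_tildeFamily (hφ : IsSTTransition φ) (hψ : IsSTTransition ψ)
    (hφ0 : φ 0 = 0) (U : Set (ℝ × ℝ)) (G : ℝ × ℝ → ℝ × ℝ) (ha : a * a = 1) (hb : b * b = 1)
    (hc₁ : c₁ * c₁ = 1) (hc₂ : c₂ * c₂ = 1) (hε : 0 < ε) (hη : 0 < η) (hs : |s| < 1)
    (hψs : ψ s = a * b * c₂ * ε / (2 * deriv φ 0))
    (hE : branchCoeff φ ψ a b c₁ c₂ ε η s ≠ 0) :
    ∃ v w, IsCodimOneEquilibrium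
        (fun u α => (tildeFamily U a b c₁ c₂ α).regularize φ ψ G ε η 0 u) (0, η * s)
        (-c₁ * (η * s)) v w ∧
      w (deriv (fun α => jac (fun u α => (tildeFamily U a b c₁ c₂ α).regularize φ ψ G ε η 0 u)
        (0, -α / c₁) α v) (-c₁ * (η * s))) ≠ 0 := by
  set α₀ := -c₁ * (η * s) with hα₀
  have hp : 0 < deriv φ 0 := hφ.deriv_pos 0 (by simp)
  have hs₁ : 0 < deriv ψ s := hψ.deriv_pos s hs
  have ha0 : a ≠ 0 := by rintro rfl; simp at ha
  have hc0 : c₁ ≠ 0 := by rintro rfl; simp at hc₁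
  have hηs : η * s / η = s := by field_simp
  have hL : deriv φ 0 / ε * ψ s = a * b * c₂ / 2 := by rw [hψs]; field_simp
  have hg := contDiff_tildeFamily (a := a) (b := b) (c₁ := c₁) (c₂ := c₂) (ε := ε) (η := η)
    hφ hψ U G
  have hgeq (u : ℝ × ℝ) (α : ℝ) := tildeFamily_regularize U a b c₁ c₂ α φ ψ G ε η u
  have hjac (x y α : ℝ) :=
    jac_eq_planarMap (hg.differentiable (by norm_num) ((x, y), α)).hasFDerivAt
  have hent (x y α : ℝ) := fderiv_tildeFamily (a := a) (b := b) (c₁ := c₁) (c₂ := c₂) (ε := ε)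
    (η := η) hφ hψ U G x y α
  set V := -c₁ * c₂ * (1 + a * b * α₀) with hV
  have hJ0 : jac (fun u α => (tildeFamily U a b c₁ c₂ α).regularize φ ψ G ε η 0 u)
      (0, η * s) α₀ = planarMap 0 0 (a * b * c₂ / 2 * (b + a * α₀)) (a / 2 * c₁) := by
    obtain ⟨e1, e2, -⟩ := hent 0 (η * s) α₀
    rw [hjac, e1, e2]
    simp only [zero_div, hφ0, hηs, hL]
    congr 1
    · linear_combination (b * c₂ / 2) * ha
    · ring
    · linear_combination (-(a * b * c₂) / 2 * a / 2) * hα₀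
    · ring
  -- The slope `V` makes `(1, V)` a null vector of the second row of the Jacobian.
  refine ⟨(1, V), ContinuousLinearMap.fst ℝ ℝ ℝ, ?_, ?_⟩
  · refine isCodimOneEquilibrium_of_det_eq_zero ?_ hJ0 (by ring) ?_ ?_ ?_ ?_
    · simp only [hgeq, zero_div, hφ0, hηs]
      ext
      · simp
      · simp
        right
        linear_combination hα₀
    · rw [zero_add]
      exact mul_ne_zero (div_ne_zero ha0 two_ne_zero) hc0
    · ext
      · simp
      · simp [hV]
        linear_combination (a * c₂ / 2) * hb - (a * c₂ * (1 + a * b * α₀) / 2) * hc₁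
    · ext <;> simp
    · rw [hess_eq_fderiv_fderiv hg.contDiffAt]
      have hP (t : ℝ) := hasDerivAt_comp_affine (x := 0) (c := 1) (ε := ε) (t := t)
        (hφ.hasDerivAt _)
      have hR (t : ℝ) := hasDerivAt_comp_affine (x := η * s) (c := V) (ε := η) (t := t)
        (hψ.hasDerivAt _)
      have hP' := (hasDerivAt_comp_affine (x := 0) (c := 1) (ε := ε) (t := 0)
        (hφ.hasDerivAt_deriv _)).mul_const (1 / ε)
      have hR' := (hasDerivAt_comp_affine (x := η * s) (c := V) (ε := η) (t := 0)
        (hψ.hasDerivAt_deriv _)).mul_const (V / η)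
      rw [fderiv_fderiv_apply_eq_of_hasDerivAt hg (ContinuousLinearMap.fst ℝ ℝ ℝ)
        (γ' := fun t => a * (deriv φ ((0 + t * 1) / ε) * (1 / ε) * ψ ((η * s + t * V) / η)
            + φ ((0 + t * 1) / ε) * (deriv ψ ((η * s + t * V) / η) * (V / η)))
          - b * c₂ / 2 * (1 * (1 + φ ((0 + t * 1) / ε) * ψ ((η * s + t * V) / η))
            + t * (deriv φ ((0 + t * 1) / ε) * (1 / ε) * ψ ((η * s + t * V) / η)
            + φ ((0 + t * 1) / ε) * (deriv ψ ((η * s + t * V) / η) * (V / η)))))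
        (q := -(2 * a * c₁ * deriv φ 0 * deriv ψ s / (ε * η)) *
          branchCoeff φ ψ a b c₁ c₂ ε η s)]
      · refine mul_ne_zero (neg_ne_zero.2 (div_ne_zero ?_ (mul_pos hε hη).ne')) hE
        exact mul_ne_zero (mul_ne_zero (mul_ne_zero (mul_ne_zero two_ne_zero ha0) hc0) hp.ne')
          hs₁.ne'
      · intro t
        have h1 := (hP t).fun_mul (hR t)
        have h2 := (h1.const_mul a).fun_sub (((hasDerivAt_id' t).fun_mul
          (h1.const_add 1)).const_mul (b * c₂ / 2))
        refine h2.congr_of_eventuallyEq (Eventually.of_forall fun x => ?_)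
        simp [Function.uncurry, hgeq]
        ring
      · have h1 := ((hP'.fun_mul (hR 0)).fun_add ((hP 0).fun_mul hR')).const_mul a
        have h2 := (hP 0).fun_mul (hR 0)
        have h3 := ((h2.const_add 1).const_mul 1).fun_add ((hasDerivAt_id' (0 : ℝ)).fun_mul
          ((hP'.fun_mul (hR 0)).fun_add ((hP 0).fun_mul hR')))
        refine (h1.fun_sub (h3.const_mul (b * c₂ / 2))).congr_deriv ?_
        simp only [zero_mul, add_zero, zero_div, hφ0, hηs]
        rw [branchCoeff, ← hα₀, hV, hψs]
        field_simp
        linear_combination (-8 * a * b * η * deriv (deriv φ) 0 * c₂ + 8 * ε * deriv φ 0 * η) * hc₁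
          - 8 * ε * deriv φ 0 * η * c₂ * c₂ * hb - 8 * ε * deriv φ 0 * η * hc₂
  · -- Only the first component matters below; the second one is left as an unevaluated derivative.
    have hD : HasDerivAt (fun α => jac (fun u α =>
        (tildeFamily U a b c₁ c₂ α).regularize φ ψ G ε η 0 u) (0, -α / c₁) α (1, V))
        (deriv φ 0 / ε * (deriv ψ s * (-1 / c₁ / η)) * a, deriv (fun α =>
          deriv φ 0 / ε * ψ (-α / c₁ / η) * (b + a / 2 * (α - c₁ * (-α / c₁)))
            + a / 2 * c₁ * V) α₀) α₀ := by
      have h0 : HasDerivAt (fun α : ℝ => -α / c₁ / η) (-1 / c₁ / η) α₀ :=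
        ((hasDerivAt_neg α₀).div_const c₁).div_const η
      have h0' : -α₀ / c₁ / η = s := by rw [hα₀]; field_simp
      have h1 : HasDerivAt (fun α => ψ (-α / c₁ / η)) (deriv ψ s * (-1 / c₁ / η)) α₀ := by
        have := hψ.hasDerivAt s
        rw [← h0'] at this
        exact (this.comp α₀ h0).congr_deriv (by rw [h0'])
      have h2 : DifferentiableAt ℝ (fun α =>
          deriv φ 0 / ε * ψ (-α / c₁ / η) * (b + a / 2 * (α - c₁ * (-α / c₁)))
            + a / 2 * c₁ * V) α₀ := by
        exact ((h1.differentiableAt.const_mul _).fun_mul (by fun_prop)).add_const _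
      refine ((((h1.const_mul (deriv φ 0 / ε)).mul_const a).sub_const
        (b * c₂ / 2)).prodMk h2.hasDerivAt).congr_of_eventuallyEq
        (Eventually.of_forall fun α => ?_)
      obtain ⟨e1, e2, -⟩ := hent 0 (-α / c₁) α
      dsimp only
      rw [hjac, e1, e2]
      simp [hφ0]
    rw [hD.deriv]
    change deriv φ 0 / ε * (deriv ψ s * (-1 / c₁ / η)) * a ≠ 0
    refine mul_ne_zero (mul_ne_zero (div_pos hp hε).ne' (mul_ne_zero hs₁.ne' ?_)) ha0
    exact div_ne_zero (div_ne_zero (by norm_num) hc0) hη.ne'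

end Tilde

/-! ### The transcritical family: the two branches of equilibria -/

lemma isSaddle_of_jetDet_neg {f : ℝ × ℝ → ℝ → ℝ × ℝ} {u : ℝ × ℝ} {μ : ℝ}
    (hf : DifferentiableAt ℝ (Function.uncurry f) (u, μ)) (h0 : f u μ = 0)
    (hdet : jetDet (fderiv ℝ (Function.uncurry f) (u, μ)) < 0) : IsSaddle f u μ :=
  isSaddle_of_det_neg h0 (jac_eq_planarMap hf.hasFDerivAt) hdet

lemma isNode_of_jetDet_pos {f : ℝ × ℝ → ℝ → ℝ × ℝ} {u : ℝ × ℝ} {μ : ℝ}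
    (hf : DifferentiableAt ℝ (Function.uncurry f) (u, μ)) (h0 : f u μ = 0)
    (hdet : 0 < jetDet (fderiv ℝ (Function.uncurry f) (u, μ)))
    (hdisc : 4 * jetDet (fderiv ℝ (Function.uncurry f) (u, μ)) <
      jetTrace (fderiv ℝ (Function.uncurry f) (u, μ)) ^ 2) : IsNode f u μ :=
  isNode_of_det_pos h0 (jac_eq_planarMap hf.hasFDerivAt) hdet hdisc

section Tilde

variable {φ ψ : ℝ → ℝ} {a b c₁ c₂ ε η s : ℝ}

/-- The equilibrium equations solved for the product of the transition functions and for the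
parameter. -/
lemma tildeFamily_eq_zero_iff (ha : a * a = 1) (hb : b * b = 1) (U : Set (ℝ × ℝ))
    (G : ℝ × ℝ → ℝ × ℝ) {x y α : ℝ} (hx : 2 - a * b * c₂ * x ≠ 0) :
    (tildeFamily U a b c₁ c₂ α).regularize φ ψ G ε η 0 (x, y) = 0 ↔
      φ (x / ε) * ψ (y / η) * (2 - a * b * c₂ * x) = a * b * c₂ * x ∧
        α = -(c₂ * x + c₁ * y * (1 - a * b * c₂ * x)) := by
  have ha0 : a ≠ 0 := by rintro rfl; simp at ha
  rw [tildeFamily_regularize, Prod.mk_eq_zero]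
  generalize φ (x / ε) * ψ (y / η) = l
  have h1 : a * l - b * c₂ / 2 * x * (1 + l) = 0 ↔
      l * (2 - a * b * c₂ * x) = a * b * c₂ * x := by
    constructor
    · intro h
      linear_combination 2 * a * h - 2 * l * ha
    · intro h
      linear_combination (a / 2) * h + (b * c₂ * x * l / 2 + b * c₂ * x / 2) * ha
  refine (and_congr_left' h1).trans (and_congr_right fun hl => ?_)
  have h2 : (2 - a * b * c₂ * x) * (b * l + a / 2 * (α * (1 + l) + c₁ * y * (1 - l))) =
      a * (α + (c₂ * x + c₁ * y * (1 - a * b * c₂ * x))) := by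
    linear_combination (b + a / 2 * (α - c₁ * y)) * hl + (a * c₂ * x) * hb
  constructor
  · intro h
    rw [h, mul_zero, eq_comm, mul_eq_zero] at h2
    linear_combination h2.resolve_left ha0
  · intro h
    rw [h, neg_add_cancel, mul_zero] at h2
    rw [← h] at h2
    exact (mul_eq_zero.1 h2).resolve_left hx

/-- The regularized family undergoes a transcritical bifurcation where the trivial branch
`x₁ = 0` meets the second branch. The latter is parametrized by `x₁`: writing
`φ(x₁/ε) = x₁ K(x₁)`, the first equilibrium equation determines `x₂ = Q(x₁)` and the second one the
parameter `α = P(x₁)`, which is locally invertible because `branchCoeff` does not vanish. -/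
theorem transcriticalAlong_tildeFamily (hφ : IsSTTransition φ) (hψ : IsSTTransition ψ)
    (hφ0 : φ 0 = 0) (U : Set (ℝ × ℝ)) (G : ℝ × ℝ → ℝ × ℝ) (ha : a * a = 1) (hb : b * b = 1)
    (hc₁ : c₁ * c₁ = 1) (hc₂ : c₂ * c₂ = 1) (hε : 0 < ε) (hη : 0 < η) (hs : |s| < 1)
    (hψs : ψ s = a * b * c₂ * ε / (2 * deriv φ 0))
    (hE : branchCoeff φ ψ a b c₁ c₂ ε η s ≠ 0) :
    TranscriticalAlong (fun u α => (tildeFamily U a b c₁ c₂ α).regularize φ ψ G ε η 0 u)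
      (fun α => (0, -α / c₁)) (-c₁ * (η * s)) := by
  set α₀ := -c₁ * (η * s) with hα₀
  have hp : 0 < deriv φ 0 := hφ.deriv_pos 0 (by simp)
  have hs₁ : 0 < deriv ψ s := hψ.deriv_pos s hs
  have ha0 : a ≠ 0 := by rintro rfl; simp at ha
  have hc0 : c₁ ≠ 0 := by rintro rfl; simp at hc₁
  have hηs : η * s / η = s := by field_simp
  have hpα₀ : -α₀ / c₁ = η * s := by rw [hα₀]; field_simp
  have hL : deriv φ 0 / ε * ψ s = a * b * c₂ / 2 := by rw [hψs]; field_simp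
  set g : ℝ × ℝ → ℝ → ℝ × ℝ :=
    fun u α => (tildeFamily U a b c₁ c₂ α).regularize φ ψ G ε η 0 u with hgdef
  have hg : ContDiff ℝ 2 (Function.uncurry g) := contDiff_tildeFamily hφ hψ U G
  have hgd : ∀ z, DifferentiableAt ℝ (Function.uncurry g) z := hg.differentiable (by norm_num)
  have hent (x y α : ℝ) := fderiv_tildeFamily (a := a) (b := b) (c₁ := c₁) (c₂ := c₂) (ε := ε)
    (η := η) hφ hψ U G x y α
  refine ⟨?_, ?_⟩
  · have := isCodimOneEquilibrium_tildeFamily hφ hψ hφ0 U G ha hb hc₁ hc₂ hε hη hs hψs hE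
    rw [← hα₀] at this
    dsimp only
    rw [hpα₀]
    exact this
  set κ := a * b * c₂ with hκ
  -- The factorization `φ(x/ε) = x K(x)`.
  have hφε (x : ℝ) : HasDerivAt (fun x => φ (x / ε)) (deriv φ (x / ε) * (1 / ε)) x := by
    simpa [Function.comp_def] using
      (hφ.hasDerivAt (x / ε)).comp x ((hasDerivAt_id' x).div_const ε)
  have hφε' (x : ℝ) : HasDerivAt (fun x => deriv φ (x / ε) * (1 / ε))
      (deriv (deriv φ) (x / ε) * (1 / ε) * (1 / ε)) x := by
    simpa [Function.comp_def] using
      ((hφ.hasDerivAt_deriv (x / ε)).comp x ((hasDerivAt_id' x).div_const ε)).mul_const (1 / ε)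
  obtain ⟨K, hK, hKeq, hK0, hK0'⟩ := exists_eq_mul_contDiff
    (f := fun x => φ (x / ε)) (hφ.contDiff.comp (by fun_prop)) (by simpa using hφ0)
  rw [funext fun x => (hφε x).deriv, (hφε' 0).deriv, zero_div] at hK0'
  rw [(hφε 0).deriv, zero_div] at hK0
  have hK0pos : 0 < K 0 := by rw [hK0]; positivity
  have hKd : HasDerivAt K (deriv K 0) 0 := (hK.differentiable (by norm_num) 0).hasDerivAt
  -- The second branch `x₂ = Q(x₁)`.
  set r : ℝ → ℝ := fun x => κ / ((2 - κ * x) * K x) with hr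
  have hr0 : r 0 = ψ s := by
    simp only [hr, hK0, hψs]
    field_simp
    ring
  have hrc : ContDiffAt ℝ 1 r 0 := by
    refine contDiffAt_const.div ((by fun_prop : ContDiffAt ℝ 1 (fun x => 2 - κ * x) 0).mul
      hK.contDiffAt) ?_
    simpa using hK0pos.ne'
  have hrd : HasDerivAt r
      ((ε * deriv φ 0 - κ * deriv (deriv φ) 0) / (4 * deriv φ 0 ^ 2)) 0 := by
    have h1 := (((hasDerivAt_id' (0 : ℝ)).const_mul κ).const_sub 2).fun_mul hKd
    have h2 := (hasDerivAt_const (0 : ℝ) κ).fun_div h1 (by simpa using hK0pos.ne')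
    refine h2.congr_deriv ?_
    have hκ2 : κ ^ 2 = 1 := by
      rw [hκ]
      linear_combination (b * b * c₂ * c₂) * ha + (c₂ * c₂) * hb + hc₂
    rw [hK0', hK0]
    field_simp
    ring_nf
    rw [hκ2]
    ring
  obtain ⟨Ψ, hΨc, hΨ0, hΨd, hΨl, hΨr⟩ := exists_localInverse
    (hψ.contDiff.of_le (by norm_num) : ContDiff ℝ 1 ψ).contDiffAt (hψ.hasDerivAt s) hs₁.ne'
  set Q : ℝ → ℝ := fun x => η * Ψ (r x) with hQ
  have hQ0 : Q 0 = η * s := by simp only [hQ, hr0, hΨ0]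
  have hΨr0 : HasDerivAt Ψ (deriv ψ s)⁻¹ (r 0) := by rw [hr0]; exact hΨd
  have hQc : ContDiffAt ℝ 1 Q 0 := by
    have h1 : ContDiffAt ℝ 1 Ψ (r 0) := by rw [hr0]; exact hΨc
    exact contDiffAt_const.mul (h1.comp 0 hrc)
  have hQd : HasDerivAt Q (η * ((deriv ψ s)⁻¹ *
      ((ε * deriv φ 0 - κ * deriv (deriv φ) 0) / (4 * deriv φ 0 ^ 2)))) 0 :=
    (hΨr0.comp 0 hrd).const_mul η
  -- The parameter along the second branch.
  set P : ℝ → ℝ := fun x => -(c₂ * x + c₁ * Q x * (1 - κ * x)) with hP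
  have hP0 : P 0 = α₀ := by simp only [hP, hQ0, hα₀]; ring
  have hPc : ContDiffAt ℝ 1 P 0 := by
    refine ContDiffAt.neg (ContDiffAt.add (by fun_prop) (ContDiffAt.mul ?_ (by fun_prop)))
    exact contDiffAt_const.mul hQc
  set d := -branchCoeff φ ψ a b c₁ c₂ ε η s with hd
  have hd0 : d ≠ 0 := neg_ne_zero.2 hE
  have hPd : HasDerivAt P d 0 := by
    have h1 := (((hasDerivAt_id' (0 : ℝ)).const_mul c₂).fun_add ((hQd.const_mul c₁).fun_mul
      (((hasDerivAt_id' (0 : ℝ)).const_mul κ).const_sub 1))).fun_neg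
    refine h1.congr_deriv ?_
    rw [hd, branchCoeff, hQ0, hκ]
    field_simp
    ring
  obtain ⟨B, hBc, hB0, hBd, hBl, hBr⟩ := exists_localInverse hPc hPd hd0
  rw [hP0] at hBc hB0 hBd hBr
  set q : ℝ → ℝ × ℝ := fun α => (B α, Q (B α)) with hq
  have hBt : Tendsto B (𝓝 α₀) (𝓝 0) := by
    have := hBc.continuousAt.tendsto
    rwa [hB0] at this
  have hq0 : q α₀ = (0, η * s) := by simp only [hq, hB0, hQ0]
  -- The points of the second branch are equilibria.
  have hpos2 : ∀ᶠ x in 𝓝 (0 : ℝ), 2 - κ * x ≠ 0 ∧ K x ≠ 0 :=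
    ((by fun_prop : Continuous fun x : ℝ => 2 - κ * x).continuousAt.eventually_ne
      (by simp)).and (hK.continuous.continuousAt.eventually_ne hK0pos.ne')
  have hψQ : ∀ᶠ x in 𝓝 (0 : ℝ), ψ (Q x / η) = r x := by
    rw [← hr0] at hΨr
    filter_upwards [hrc.continuousAt.eventually hΨr] with x hx
    simp only [hQ]
    rwa [mul_div_cancel_left₀ _ hη.ne']
  have hcurve : ∀ᶠ x in 𝓝 (0 : ℝ), g (x, Q x) (P x) = 0 := by
    filter_upwards [hpos2, hψQ] with x hx hx'
    refine (tildeFamily_eq_zero_iff ha hb U G hx.1).2 ⟨?_, rfl⟩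
    rw [hx', hKeq, ← hκ]
    obtain ⟨h1, h2⟩ := hx
    have h1' : 2 - x * κ ≠ 0 := by rwa [mul_comm x]
    simp only [hr]
    field_simp
  -- Conversely, equilibria near the bifurcation point lie on one of the two branches.
  have hconv : ∀ᶠ u in 𝓝 ((0, η * s) : ℝ × ℝ), B (P u.1) = u.1 ∧
      ∀ α, g u α = 0 → α = P u.1 ∧ u.2 = Q u.1 ∨ u = (0, -α / c₁) := by
    have t1 : Tendsto (fun u : ℝ × ℝ => u.1) (𝓝 (0, η * s)) (𝓝 0) := continuous_fst.tendsto _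
    have t2 : Tendsto (fun u : ℝ × ℝ => u.2 / η) (𝓝 (0, η * s)) (𝓝 s) := by
      have : Continuous fun u : ℝ × ℝ => u.2 / η := by fun_prop
      exact this.tendsto' _ _ hηs
    filter_upwards [t1.eventually hBl, t1.eventually hpos2, t2.eventually hΨl] with u h1 h2 h3
    refine ⟨h1, fun α h0 => ?_⟩
    obtain ⟨x, y⟩ := u
    obtain ⟨h4, h5⟩ := (tildeFamily_eq_zero_iff ha hb U G h2.1).1 h0
    simp only at h2 h3 h4 h5 ⊢
    by_cases hx : x = 0
    · right
      rw [hx] at h5 ⊢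
      rw [Prod.mk.injEq]
      refine ⟨rfl, ?_⟩
      rw [h5]
      field_simp
      ring
    · left
      have h6 : ψ (y / η) = r x := by
        obtain ⟨h7, h8⟩ := h2
        rw [hKeq] at h4
        simp only [hr]
        rw [eq_div_iff (mul_ne_zero h7 h8)]
        exact mul_left_cancel₀ hx (by linear_combination h4)
      have h7 : y = Q x := by
        simp only [hQ]
        rw [← h6, h3]
        field_simp
      refine ⟨?_, h7⟩
      rw [h5, h7]
  obtain ⟨N, hN, hNo, hN0⟩ := eventually_nhds_iff.1 hconv
  -- The determinant along the second branch.
  set W : ℝ → ℝ := fun x => K x * (deriv ψ (Q x / η) / η) * (a - b * c₂ / 2 * x) *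
    (a / 2 * (1 + φ (x / ε) * ψ (Q x / η))) * deriv P x with hW
  have hdetq : ∀ᶠ x in 𝓝 (0 : ℝ),
      jetDet (fderiv ℝ (Function.uncurry g) ((x, Q x), P x)) = x * W x := by
    filter_upwards [hcurve.eventually_nhds, hQc.eventually (by simp), hPc.eventually (by simp)]
      with x h1 h2 h3
    have h4 : HasDerivAt Q (deriv Q x) x := (h2.differentiableAt (by norm_num)).hasDerivAt
    have h5 : HasDerivAt P (deriv P x) x := (h3.differentiableAt (by norm_num)).hasDerivAt
    have h6 := HasFDerivAt.comp_hasDerivAt (f := fun x => ((x, Q x), P x)) x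
      (hgd ((x, Q x), P x)).hasFDerivAt (((hasDerivAt_id' x).prodMk h4).prodMk h5)
    have h7 := h6.unique ((hasDerivAt_const x (0 : ℝ × ℝ)).congr_of_eventuallyEq h1)
    obtain ⟨e1, e2, e3⟩ := hent x (Q x) (P x)
    rw [jet_apply, e1, e2, e3] at h7
    have h8 := congrArg Prod.fst h7
    have h9 := congrArg Prod.snd h7
    simp only [Prod.smul_mk, smul_eq_mul, Prod.mk_add_mk, Prod.fst_zero, Prod.snd_zero, one_mul,
      mul_zero, add_zero] at h8 h9
    rw [jetDet, e1, e2]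
    simp only [hW]
    rw [hKeq x] at *
    linear_combination (x * K x * (deriv ψ (Q x / η) / η) * (b + a / 2 * (P x - c₁ * Q x))
      + a / 2 * c₁ * (1 - x * K x * ψ (Q x / η))) * h8
      - (x * K x * (deriv ψ (Q x / η) / η) * (a - b * c₂ / 2 * x)) * h9
  have hWpos : ∀ᶠ x in 𝓝 (0 : ℝ), 0 < d * W x := by
    have hQη : ContinuousAt (fun x => Q x / η) 0 := hQc.continuousAt.div_const η
    have c1 : ContinuousAt (fun x => deriv ψ (Q x / η)) 0 :=
      hψ.contDiff_deriv.continuous.continuousAt.comp hQη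
    have c2 : ContinuousAt (fun x => φ (x / ε) * ψ (Q x / η)) 0 :=
      (hφε 0).continuousAt.mul (hψ.contDiff.continuous.continuousAt.comp hQη)
    have c3 : ContinuousAt (fun x => d * W x) 0 := by
      refine continuousAt_const.mul (((((hK.continuous.continuousAt).mul
        (c1.div_const η)).mul (by fun_prop)).mul ?_).mul (continuousAt_deriv_of_contDiffAt hPc))
      exact continuousAt_const.mul (continuousAt_const.add c2)
    refine c3.eventually (lt_mem_nhds ?_)
    have h1 : d * W 0 = K 0 * (deriv ψ s / η) * (a * a) / 2 * (d * d) := by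
      simp only [hW, hPd.deriv, hQ0, hηs, zero_div, hφ0]
      ring
    dsimp only
    rw [h1, ha]
    have h2 : 0 < d * d := mul_self_pos.2 hd0
    positivity
  have hsq : ∀ᶠ α in 𝓝 α₀, α ≠ α₀ →
      0 < jetDet (fderiv ℝ (Function.uncurry g) (q α, α)) * (α - α₀) := by
    filter_upwards [eventually_mul_pos_of_hasDerivAt hBd (inv_ne_zero hd0) hB0, hBr,
      hBt.eventually hdetq, hBt.eventually hWpos] with α h1 h2 h3 h4 hne
    rw [h2] at h3
    rw [h3]
    have h5 := mul_pos h4 (h1 hne)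
    have h6 : d * W (B α) * (d⁻¹ * B α * (α - α₀)) = B α * W (B α) * (α - α₀) := by
      field_simp
    rwa [h6] at h5
  -- The determinant along the trivial branch.
  have hsp : ∀ᶠ α in 𝓝 α₀, α ≠ α₀ →
      jetDet (fderiv ℝ (Function.uncurry g) ((0, -α / c₁), α)) * (α - α₀) < 0 := by
    have h0 : HasDerivAt (fun α : ℝ => -α / c₁ / η) (-1 / c₁ / η) α₀ :=
      ((hasDerivAt_neg α₀).div_const c₁).div_const η
    have h0' : -α₀ / c₁ / η = s := by rw [hpα₀, hηs]
    have h1 : HasDerivAt (fun α => ψ (-α / c₁ / η)) (deriv ψ s * (-1 / c₁ / η)) α₀ := by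
      have := hψ.hasDerivAt s
      rw [← h0'] at this
      exact (this.comp α₀ h0).congr_deriv (by rw [h0'])
    have h2 := (((h1.const_mul (deriv φ 0 / ε)).mul_const a).sub_const (b * c₂ / 2)).mul_const
      (a / 2 * c₁)
    have h3 : deriv φ 0 / ε * (deriv ψ s * (-1 / c₁ / η)) * a * (a / 2 * c₁) =
        -(deriv φ 0 / ε * (deriv ψ s / η) / 2) := by
      field_simp
      linear_combination -ha
    rw [h3] at h2
    have hneg : -(deriv φ 0 / ε * (deriv ψ s / η) / 2) < 0 := by
      have : 0 < deriv φ 0 / ε * (deriv ψ s / η) / 2 := by positivity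
      linarith
    filter_upwards [eventually_mul_pos_of_hasDerivAt h2 hneg.ne (by
      rw [h0', hL, hκ]; linear_combination (b * c₂ / 2 * (a / 2 * c₁)) * ha)] with α h4 hne
    obtain ⟨e1, e2, -⟩ := hent 0 (-α / c₁) α
    have h5 : jetDet (fderiv ℝ (Function.uncurry g) ((0, -α / c₁), α)) =
        (deriv φ 0 / ε * ψ (-α / c₁ / η) * a - b * c₂ / 2) * (a / 2 * c₁) := by
      rw [jetDet, e1, e2]
      simp [hφ0]
    have h6 := h4 hne
    rw [← h5, mul_assoc] at h6
    exact (neg_iff_neg_of_mul_pos h6).1 hneg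
  -- Near the bifurcation point the eigenvalues are real.
  have hdisc : ∀ ζ : ℝ → ℝ × ℝ, ContinuousAt ζ α₀ → ζ α₀ = (0, η * s) → ∀ᶠ α in 𝓝 α₀,
      4 * jetDet (fderiv ℝ (Function.uncurry g) (ζ α, α)) <
        jetTrace (fderiv ℝ (Function.uncurry g) (ζ α, α)) ^ 2 := by
    intro ζ hζ hζ0
    have hA : Continuous (fderiv ℝ (Function.uncurry g)) := hg.continuous_fderiv (by norm_num)
    have hc : Continuous fun z => jetTrace (fderiv ℝ (Function.uncurry g) z) ^ 2
        - 4 * jetDet (fderiv ℝ (Function.uncurry g) z) :=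
      ((continuous_jetTrace.comp hA).pow 2).sub
        (continuous_const.mul (continuous_jetDet.comp hA))
    have hc' : ContinuousAt (fun α => jetTrace (fderiv ℝ (Function.uncurry g) (ζ α, α)) ^ 2
        - 4 * jetDet (fderiv ℝ (Function.uncurry g) (ζ α, α))) α₀ :=
      ContinuousAt.comp (f := fun α => (ζ α, α)) hc.continuousAt (hζ.prodMk continuousAt_id)
    refine (hc'.eventually (lt_mem_nhds (a := 0) ?_)).mono fun α h => sub_pos.1 h
    obtain ⟨e1, e2, -⟩ := hent 0 (η * s) α₀
    have h1 : a * b * c₂ / 2 * a - b * c₂ / 2 = 0 := by linear_combination (b * c₂ / 2) * ha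
    have h2 : jetDet (fderiv ℝ (Function.uncurry g) ((0, η * s), α₀)) = 0 := by
      rw [jetDet, e1, e2]
      simp only [zero_div, hφ0, hηs, hL, hκ]
      linear_combination (a / 2 * c₁) * h1
    have h3 : jetTrace (fderiv ℝ (Function.uncurry g) ((0, η * s), α₀)) = a / 2 * c₁ := by
      rw [jetTrace, e1, e2]
      simp only [zero_div, hφ0, hηs, hL, hκ]
      linear_combination h1
    dsimp only
    rw [hζ0, h2, h3, mul_zero, sub_zero]
    have := mul_ne_zero (div_ne_zero ha0 two_ne_zero) hc0
    positivity
  have hpc : Continuous fun α : ℝ => ((0, -α / c₁) : ℝ × ℝ) := by fun_prop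
  have hqc : ∀ᶠ α in 𝓝 α₀, ContDiffAt ℝ 1 q α := by
    have h1 : ContDiffAt ℝ 1 q α₀ := by
      have h2 : ContDiffAt ℝ 1 Q (B α₀) := by rw [hB0]; exact hQc
      exact hBc.prodMk (h2.comp α₀ hBc)
    exact h1.eventually (by simp)
  have hpN : ∀ᶠ α in 𝓝 α₀, ((0, -α / c₁) : ℝ × ℝ) ∈ N :=
    hpc.continuousAt.eventually (hNo.mem_nhds (by dsimp only; rw [hpα₀]; exact hN0))
  have hqN : ∀ᶠ α in 𝓝 α₀, q α ∈ N :=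
    hqc.self_of_nhds.continuousAt.eventually (hNo.mem_nhds (by rw [hq0]; exact hN0))
  have hqz : ∀ᶠ α in 𝓝 α₀, g (q α) α = 0 := by
    filter_upwards [hBt.eventually hcurve, hBr] with α h1 h2
    rwa [h2] at h1
  have hpz : ∀ α, g (0, -α / c₁) α = 0 := by
    intro α
    refine (tildeFamily_eq_zero_iff ha hb U G (by simp)).2 ⟨by simp [hφ0], ?_⟩
    field_simp
    ring
  obtain ⟨δ, hδ, hall⟩ := Metric.eventually_nhds_iff_ball.1 (hqc.and (hpN.and (hqN.and (hqz.and
    (hsp.and (hsq.and ((hdisc _ hpc.continuousAt (by rw [hpα₀])).and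
      (hdisc q hqc.self_of_nhds.continuousAt hq0))))))))
  rw [Real.ball_eq_Ioo] at hall
  refine ⟨N, δ, q, hNo, by dsimp only; rw [hpα₀]; exact hN0, hδ,
    by dsimp only; rw [hpα₀, hq0], by fun_prop,
    fun α hα => (hall α hα).1.contDiffWithinAt, ?_, ?_, Or.inr ⟨?_, ?_⟩⟩
  · have h1 : HasDerivAt (fun α : ℝ => ((0, -α / c₁) : ℝ × ℝ)) (0, -1 / c₁) α₀ :=
      (hasDerivAt_const α₀ (0 : ℝ)).prodMk ((hasDerivAt_neg α₀).div_const c₁)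
    have h2 : HasDerivAt (fun α => (q α).1) (deriv q α₀).1 α₀ :=
      (ContinuousLinearMap.fst ℝ ℝ ℝ).hasFDerivAt.comp_hasDerivAt α₀
        (hqc.self_of_nhds.differentiableAt (by norm_num)).hasDerivAt
    intro h3
    rw [h1.deriv] at h3
    rw [← h3] at h2
    exact inv_ne_zero hd0 (hBd.unique h2)
  · intro α hα
    obtain ⟨-, h1, h2, h3, -⟩ := hall α hα
    ext u
    constructor
    · rintro ⟨hu, hz⟩
      obtain ⟨h4, h5⟩ := hN u hu
      rcases h5 α hz with ⟨h6, h7⟩ | h6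
      · right
        rw [← h6] at h4
        exact Prod.ext h4.symm (by rw [h7]; simp only [hq, h4])
      · exact Or.inl h6
    · rintro (rfl | rfl)
      · exact ⟨h1, hpz α⟩
      · exact ⟨h2, h3⟩
  · intro α hα
    obtain ⟨-, -, -, h3, h4, h5, h6, -⟩ := hall α ⟨hα.1, by linarith [hα.2]⟩
    have hlt : α - α₀ < 0 := sub_neg.2 hα.2
    exact ⟨isNode_of_jetDet_pos (hgd _) (hpz α)
        (pos_of_mul_neg_left (h4 hα.2.ne) hlt.le) h6,
      isSaddle_of_jetDet_neg (hgd _) h3 ((neg_iff_neg_of_mul_pos (h5 hα.2.ne)).2 hlt)⟩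
  · intro α hα
    obtain ⟨-, -, -, h3, h4, h5, -, h7⟩ := hall α ⟨by linarith [hα.1], hα.2⟩
    have hlt : 0 < α - α₀ := sub_pos.2 hα.1
    exact ⟨isSaddle_of_jetDet_neg (hgd _) (hpz α) (neg_of_mul_neg_left (h4 hα.1.ne') hlt.le),
      isNode_of_jetDet_pos (hgd _) h3 ((pos_iff_pos_of_mul_pos (h5 hα.1.ne')).2 hlt) h7⟩

end Tilde

/-! ### The parameter value of the transcritical bifurcation -/

/-- The derivative of a transition function vanishes at `±1`, but it is bounded below where the
function stays away from `±1`. -/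
theorem IsSTTransition.exists_pos_le_deriv {ψ : ℝ → ℝ} (hψ : IsSTTransition ψ) :
    ∃ m > 0, ∀ t, |t| < 1 → |ψ t| ≤ 1 / 2 → m ≤ deriv ψ t := by
  have hcd : Continuous (deriv ψ) := hψ.contDiff_deriv.continuous
  have hS : IsCompact (Icc (-1 : ℝ) 1 ∩ {t | |ψ t| ≤ 1 / 2}) :=
    isCompact_Icc.inter_right (isClosed_le hψ.contDiff.continuous.abs continuous_const)
  have hlt : ∀ t ∈ Icc (-1 : ℝ) 1 ∩ {t | |ψ t| ≤ 1 / 2}, |t| < 1 := by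
    rintro t ⟨ht, h2⟩
    refine lt_of_le_of_ne (abs_le.2 ht) fun h => ?_
    change |ψ t| ≤ 1 / 2 at h2
    rcases eq_or_eq_neg_of_abs_eq h with rfl | rfl
    · rw [hψ.apply_one] at h2; norm_num at h2
    · rw [hψ.apply_neg_one] at h2; norm_num at h2
  obtain ⟨t₁, ht₁, h0⟩ := hψ.exists_apply_eq (y := 0) (by simp)
  obtain ⟨t₀, ht₀, hmin⟩ := hS.exists_isMinOn
    ⟨t₁, abs_le.1 ht₁.le, by simp [h0]⟩ hcd.continuousOn
  exact ⟨deriv ψ t₀, hψ.deriv_pos _ (hlt _ ht₀), fun t ht h => hmin ⟨abs_le.1 ht.le, h⟩⟩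

/-- The coefficient is a number of absolute value at least `1 - η` plus a term of order
`η / ψ'(s)`. -/
theorem branchCoeff_ne_zero {φ ψ : ℝ → ℝ} {a b c₁ c₂ ε η s m : ℝ}
    (ha : a * a = 1) (hb : b * b = 1) (hc₁ : c₁ * c₁ = 1) (hc₂ : c₂ * c₂ = 1)
    (hp : 0 < deriv φ 0) (hε : 0 < ε) (hε1 : ε < 1) (hη : 0 < η) (hη1 : η < 1 / 2) (hs : |s| < 1)
    (hm : 0 < m) (hms : m ≤ deriv ψ s)
    (hηm : η * (deriv φ 0 + |deriv (deriv φ) 0|) < m * (2 * deriv φ 0 ^ 2)) :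
    branchCoeff φ ψ a b c₁ c₂ ε η s ≠ 0 := by
  have habs : ∀ {x : ℝ}, x * x = 1 → |x| = 1 := fun {x} h => by
    rw [← sq_eq_sq₀ (abs_nonneg x) zero_le_one, sq_abs]; linarith [sq x]
  set p := deriv φ 0
  set r := deriv (deriv φ) 0
  have h1 : |c₁ * (η / deriv ψ s) * ((ε * p - a * b * c₂ * r) / (4 * p ^ 2))| < 1 / 2 := by
    have hnum : |ε * p - a * b * c₂ * r| ≤ p + |r| := by
      refine (abs_sub _ _).trans (add_le_add ?_ ?_)
      · rw [abs_of_pos (mul_pos hε hp)]; nlinarith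
      · simp only [abs_mul, habs ha, habs hb, habs hc₂, one_mul, le_refl]
    have hd : 0 < deriv ψ s := hm.trans_le hms
    rw [abs_mul, abs_mul, habs hc₁, one_mul, abs_div, abs_div, abs_of_pos hη, abs_of_pos hd,
      abs_of_pos (show 0 < 4 * p ^ 2 by positivity), div_mul_div_comm, div_lt_iff₀ (by positivity)]
    calc η * |ε * p - a * b * c₂ * r| ≤ η * (p + |r|) := by gcongr
      _ < m * (2 * p ^ 2) := hηm
      _ ≤ 1 / 2 * (deriv ψ s * (4 * p ^ 2)) := by
        nlinarith [mul_le_mul_of_nonneg_right hms (sq_nonneg p)]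
  have h2 : 1 / 2 ≤ |c₂ * (1 + a * b * (-c₁ * (η * s)))| := by
    have h3 : |a * b * (-c₁ * (η * s))| ≤ 1 / 2 := by
      simp only [abs_mul, abs_neg, habs ha, habs hb, habs hc₁, one_mul, abs_of_pos hη]
      nlinarith
    rw [abs_mul, habs hc₂, one_mul]
    have := abs_le.1 h3
    exact (by linarith : (1 : ℝ) / 2 ≤ 1 + a * b * (-c₁ * (η * s))).trans (le_abs_self _)
  intro h
  rw [branchCoeff, add_eq_zero_iff_eq_neg] at h
  rw [h, abs_neg] at h2
  exact absurd h1 h2.not_gt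

/-- The coordinate `s` with `x₂ = η s` at the bifurcation point is determined by
`ψ s = κ ε / (2 φ'(0))`, `κ = a b c₂`. The right-hand side is at most `1 / 2` in absolute value for
`ε < φ'(0)`, which keeps `ψ'(s)` away from zero and so makes the nondegeneracy condition hold
uniformly for small `η`. -/
theorem exists_transcritical_parameter {φ ψ : ℝ → ℝ} (hφ : IsSTTransition φ)
    (hψ : IsSTTransition ψ) {a b c₁ c₂ : ℝ}
    (ha : a * a = 1) (hb : b * b = 1) (hc₁ : c₁ * c₁ = 1) (hc₂ : c₂ * c₂ = 1) :
    ∃ ε₀ > 0, ∃ η₀ > 0, ∃ s : ℝ → ℝ, (∀ ε, |s ε| < 1) ∧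
      ∀ ε ∈ Ioo 0 ε₀, ψ (s ε) = a * b * c₂ * ε / (2 * deriv φ 0) ∧
        ∀ η ∈ Ioo 0 η₀, branchCoeff φ ψ a b c₁ c₂ ε η (s ε) ≠ 0 := by
  have hp : 0 < deriv φ 0 := hφ.deriv_pos 0 (by simp)
  have hκ : |a * b * c₂| = 1 := by
    rw [← sq_eq_sq₀ (abs_nonneg _) zero_le_one, sq_abs]
    linear_combination (b * b * (c₂ * c₂)) * ha + c₂ * c₂ * hb + hc₂
  have hy : ∀ ε ∈ Ioo 0 (deriv φ 0), |a * b * c₂ * ε / (2 * deriv φ 0)| ≤ 1 / 2 := by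
    intro ε hε
    rw [abs_div, abs_mul, hκ, one_mul, abs_of_pos hε.1, abs_of_pos (by positivity),
      div_le_iff₀ (by positivity)]
    linarith [hε.2]
  obtain ⟨m, hm, hmψ⟩ := hψ.exists_pos_le_deriv
  have hex : ∀ ε, ∃ s, |s| < 1 ∧
      (ε ∈ Ioo 0 (deriv φ 0) → ψ s = a * b * c₂ * ε / (2 * deriv φ 0)) := by
    intro ε
    by_cases hε : ε ∈ Ioo 0 (deriv φ 0)
    · obtain ⟨t, ht, h⟩ := hψ.exists_apply_eq ((hy ε hε).trans_lt (by norm_num))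
      exact ⟨t, ht, fun _ => h⟩
    · exact ⟨0, by simp, fun h => absurd h hε⟩
  choose s hs1 hs using hex
  have hpr : 0 < deriv φ 0 + |deriv (deriv φ) 0| := by positivity
  refine ⟨min 1 (deriv φ 0), by positivity,
    min (1 / 2) (m * (2 * deriv φ 0 ^ 2) / (deriv φ 0 + |deriv (deriv φ) 0|)), by positivity,
    s, hs1, fun ε hε => ?_⟩
  have hε' : ε ∈ Ioo 0 (deriv φ 0) := ⟨hε.1, hε.2.trans_le (min_le_right _ _)⟩
  refine ⟨hs ε hε', fun η hη => ?_⟩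
  refine branchCoeff_ne_zero ha hb hc₁ hc₂ hp hε.1 (hε.2.trans_le (min_le_left _ _)) hη.1
    (hη.2.trans_le (min_le_left _ _)) (hs1 ε) hm
    (hmψ _ (hs1 ε) (by rw [hs ε hε']; exact hy ε hε')) ?_
  exact (lt_div_iff₀ hpr).1 (hη.2.trans_le (min_le_right _ _))

end CrossField

end

theorem theorem4 {U : Set (ℝ × ℝ)} (hU : IsOpen U) (hUb : Bornology.IsBounded U)
    (h0 : (0 : ℝ × ℝ) ∈ U)
    (Z : CrossField.PiecewiseField U) (hZ : Z.CondB1)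
    (a b c₁ c₂ : ℝ) (ha : a = Real.sign (Z.X 0).1) (hb : b = Real.sign (Z.X 0).2)
    (hc₁ : c₁ = Real.sign Z.detDx₂) (hc₂ : c₂ = Real.sign Z.detDx₁)
    (φ ψ : ℝ → ℝ) (hφ : CrossField.IsSTTransition φ) (hψ : CrossField.IsSTTransition ψ)
    (hφ0 : φ 0 = 0) (G : ℝ × ℝ → ℝ × ℝ) :
    -- (i)
    (CrossField.CrossesB1 (CrossField.tildeFamily U a b c₁ c₂) ∧
      ∃ ε₀ > 0, ∃ η₀ > 0, ∃ α₀ : ℝ → ℝ → ℝ,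
        Tendsto (fun e : ℝ × ℝ => α₀ e.1 e.2) (𝓝[>] 0 ×ˢ 𝓝[>] 0) (𝓝 0) ∧
        ∀ ε ∈ Ioo 0 ε₀, ∀ η ∈ Ioo 0 η₀,
          ((0, -α₀ ε η / c₁) : ℝ × ℝ) ∈ U ∧
          CrossField.TranscriticalAlong
            (fun u α => (CrossField.tildeFamily U a b c₁ c₂ α).regularize φ ψ G ε η 0 u)
            (fun α => (0, -α / c₁)) (α₀ ε η) ∧
          ∀ k : ℕ, 2 ≤ k → ¬ CrossField.IsGenericAt CrossField.TranscriticalAt k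
            (fun u α => (CrossField.tildeFamily U a b c₁ c₂ α).regularize φ ψ G ε η 0 u)
            (0, -α₀ ε η / c₁) (α₀ ε η)) ∧
    -- (ii)
    (ψ 0 = 0 →
      CrossField.CrossesB1 (CrossField.hatFamily U a b c₁ c₂) ∧
      ∃ ε₀ > 0, ∃ η₀ > 0, ∀ ε ∈ Ioo 0 ε₀, ∀ η ∈ Ioo 0 η₀,
        CrossField.SaddleNodeAt
          (fun u β => (CrossField.hatFamily U a b c₁ c₂ β).regularize φ ψ G ε η 0 u) 0 0 ∧
        ∀ k : ℕ, 2 ≤ k → CrossField.IsGenericAt CrossField.SaddleNodeAt k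
          (fun u β => (CrossField.hatFamily U a b c₁ c₂ β).regularize φ ψ G ε η 0 u) 0 0) := by
  obtain ⟨h1, h2, -, h3, h4⟩ := hZ
  have ha' : a * a = 1 := ha ▸ CrossField.sign_mul_self (left_ne_zero_of_mul h1.ne)
  have hb' : b * b = 1 := hb ▸ CrossField.sign_mul_self (left_ne_zero_of_mul h2.ne)
  have hc₁' : c₁ * c₁ = 1 := hc₁ ▸ CrossField.sign_mul_self h4
  have hc₂' : c₂ * c₂ = 1 := hc₂ ▸ CrossField.sign_mul_self h3
  have hc₁0 : c₁ ≠ 0 := left_ne_zero_of_mul_eq_one hc₁'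
  have hc₂0 : c₂ ≠ 0 := left_ne_zero_of_mul_eq_one hc₂'
  have hp : 0 < deriv φ 0 := hφ.deriv_pos 0 (by simp)
  have hq : 0 < deriv ψ 0 := hψ.deriv_pos 0 (by simp)
  refine ⟨⟨CrossField.crossesB1_tildeFamily U ha' hb' hc₁0 hc₂0, ?_⟩, fun hψ0 =>
    ⟨CrossField.crossesB1_hatFamily U ha' hb' hc₁0 hc₂0, ?_⟩⟩
  · obtain ⟨ε₀, hε₀, η₀, hη₀, s, hs, H⟩ :=
      CrossField.exists_transcritical_parameter hφ hψ ha' hb' hc₁' hc₂'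
    obtain ⟨ρ, hρ, hρU⟩ := Metric.isOpen_iff.1 hU 0 h0
    -- `η₀ ≤ ρ` keeps the bifurcation point `(0, η s)` inside `U`.
    refine ⟨ε₀, hε₀, min η₀ ρ, lt_min hη₀ hρ, fun ε η => -c₁ * (η * s ε), ?_, ?_⟩
    · have hlim : Tendsto (fun e : ℝ × ℝ => e.2) (𝓝[>] 0 ×ˢ 𝓝[>] 0) (𝓝 0) :=
        tendsto_snd.mono_right nhdsWithin_le_nhds
      have := (hlim.zero_mul_isBoundedUnder_le (g := fun e : ℝ × ℝ => s e.1)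
        ⟨1, eventually_map.2 (Eventually.of_forall fun e => (hs e.1).le)⟩).const_mul (-c₁)
      simpa only [mul_zero] using this
    · intro ε hε η hη
      have hy : -(-c₁ * (η * s ε)) / c₁ = η * s ε := by field_simp
      have hlt : |η * s ε| < η := by
        rw [abs_mul, abs_of_pos hη.1]
        exact mul_lt_of_lt_one_right hη.1 (hs ε)
      refine ⟨hρU ?_, ?_, fun k _ => ?_⟩
      · rw [hy, mem_ball_zero_iff, Prod.norm_def, norm_zero, Real.norm_eq_abs]
        exact max_lt hρ (hlt.trans (hη.2.trans_le (min_le_right _ _)))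
      · exact CrossField.transcriticalAlong_tildeFamily hφ hψ hφ0 U G ha' hb' hc₁' hc₂' hε.1 hη.1
          (hs ε) (H ε hε).1 ((H ε hε).2 η ⟨hη.1, hη.2.trans_le (min_le_left _ _)⟩)
      · rw [hy]
        exact CrossField.not_isGenericAt_transcriticalAt_tildeFamily hφ hψ hφ0 U G ha' hb' hc₂'
          hε.1 hη.1 hlt k
  · refine ⟨2 * (deriv φ 0 * deriv ψ 0), by positivity, 1, one_pos, fun ε hε η hη => ?_⟩
    have hεη : ε * η < 2 * (deriv φ 0 * deriv ψ 0) :=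
      (mul_lt_of_lt_one_right hε.1 hη.2).trans hε.2
    obtain ⟨hdet, hF⟩ := CrossField.isFoldJet_hatFamily hφ hψ hφ0 hψ0 U G ha' hb' hc₁' hc₂'
      hε.1 hη.1 hεη
    have hg := CrossField.contDiff_hatFamily hφ hψ U G (a := a) (b := b) (c₁ := c₁) (c₂ := c₂)
      (ε := ε) (η := η)
    have hz : (Function.uncurry fun u β =>
        (CrossField.hatFamily U a b c₁ c₂ β).regularize φ ψ G ε η 0 u) 0 = 0 := by
      simp [CrossField.hatFamily_regularize, Function.uncurry, hφ0]
    exact ⟨CrossField.saddleNodeAt_of_isFoldJet (z₀ := 0) hg.contDiffAt hz hdet hF,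
      fun k hk => CrossField.isGenericAt_saddleNodeAt_of_isFoldJet (z₀ := 0) hg hz hdet hF hk⟩
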